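/- All algorithms are randomized and adaptive, with access to independent samples from unknown distributions; the number of samples an algorithm uses is the worst case over all sample values and all internal randomness. For distributions on a finite set, $\mathrm{TV}(p,q)=\frac12\sum_x|p(x)-q(x)|$ and $\|p\|_2^2=\sum_x p(x)^2$. A distribution is $\varepsilon$-far from product if its total variation distance to every product distribution is at least $\varepsilon$. *Subroutines.* An $\ell_2^2$-norm estimator $E$ is a family of algorithms such that, for every $N$ and $\delta\in(0,1/2]$, $E(N,\delta)$ uses $O(\sqrt N\log(1/\delta))$ samples from an unknown distribution $p$ on $[N]$ and outputs $L$ with $\frac12\|p\|_2^2\le L\le\frac32\|p\|_2^2$ with probability at least $1-\delta$. A closeness tester $T$ is a family of algorithms such that, for every $N$, $b>0$, $\varepsilon\in(0,1)$, $\delta\in(0,1/2]$, $T(N,b,\varepsilon,\delta)$ uses $O(N\sqrt b\,\varepsilon^{-2}\log(1/\delta))$ samples from two unknown distributions $p,q$ on $[N]$ and, whenever $b\ge\min(\|p\|_2^2,\|q\|_2^2)$, accepts with probability at least $1-\delta$ if $p=q$ and rejects with probability at least $1-\delta$ if $\mathrm{TV}(p,q)\ge\varepsilon$. *Algorithm 1.*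 Input: $n,m$, $\alpha$, $\varepsilon$, a prediction $\hat p$ on $[n]\times[m]$ with marginals $\hat p_1,\hat p_2$, and sample access to $p$ on $[n]\times[m]$ with marginals $p_1,p_2$. Let $s_1=\min(n^{2/3}m^{1/3}\alpha^{1/3}\varepsilon^{-4/3},\,n\alpha)$, $s_2=m\alpha$, $\tau_1=\frac{2\alpha}{s_1}+\frac4n$, $\tau_2=\frac{2\alpha}{s_2}+\frac4m$ (with $0/0=0$ when $\alpha=0$), $c=120$, $c'=160$. 1. Draw $\hat s_1\sim\mathrm{Poi}(s_1)$ and $\hat s_2\sim\mathrm{Poi}(s_2)$. If $\hat s_1>c's_1$ or $\hat s_2>c's_2$, output *reject*. 2. Draw $\hat s_1$ samples from $p_1$ and $\hat s_2$ samples from $p_2$, and let $N^{(1)}_i$, $N^{(2)}_j$ be the frequencies of $i\in[n]$ and $j\in[m]$. Put $b^{(1)}_i=\lfloor n\hat p_1(i)\rfloor+N^{(1)}_i+1$ and $b^{(2)}_j=\lfloor m\hat p_2(j)\rfloor+N^{(2)}_j+1$, $B_1=\sum_i b^{(1)}_i$, $B_2=\sum_j b^{(2)}_j$. Let $p_1^{(F_1)}$,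 $p_2^{(F_2)}$, $p^{(F)}$ be the distributions obtained by sending $i$ to $(i,k)$, $j$ to $(j,\ell)$, and $(i,j)$ to $(i,j,k,\ell)$, with $k\in[b^{(1)}_i]$ and $\ell\in[b^{(2)}_j]$ uniform and independent. 3. With fresh samples, obtain estimates $L_1$ of $\|p_1^{(F_1)}\|_2^2$ from $E(B_1,1/120)$ and $L_2$ of $\|p_2^{(F_2)}\|_2^2$ from $E(B_2,1/120)$. If $L_1>c\tau_1$ or $L_2>c\tau_2$, output *inaccurate information*. 4. With fresh samples, obtain an estimate $L$ of $\|p^{(F)}\|_2^2$ from $E(B_1B_2,1/120)$. If $L>10c^2\tau_1\tau_2$, output *reject*. 5. With fresh samples, run $T(B_1B_2,\,4c^2\tau_1\tau_2,\,\varepsilon,\,1/80)$ on $p^{(F)}$ and $p_1^{(F_1)}\times p_2^{(F_2)}$ and output its answer (*accept* or *reject*). *Augmented testers.* An algorithm that is given a prediction $\hat p$ and samples from $p$, and outputs *accept*, *reject* or *inaccurate information*, is an $(\alpha,\varepsilon,\delta)$-augmented independence tester on $[n]\times[m]$ if for all distributions $p,\hat p$ on $[n]\times[m]$: (i) if $p$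 is a product distribution, it outputs *reject* with probability at most $\delta/2$; (ii) if $p$ is $\varepsilon$-far from product, it outputs *accept* with probability at most $\delta/2$; (iii) if $\mathrm{TV}(p,\hat p)\le\alpha$, it outputs *inaccurate information* with probability at most $\delta/2$. **Theorem.** $\ell_2^2$-norm estimators and closeness testers as above exist, and for every choice of such $E$ and $T$ there is a constant $C>0$ such that for all integers $n\ge m\ge2$, all $\varepsilon\in(0,1)$ and all $\alpha\in[0,1]$, Algorithm 1 is an $(\alpha,\varepsilon,0.1)$-augmented independence tester on $[n]\times[m]$ that, for every prediction $\hat p$, uses at most $$C\cdot\max\left\{\frac{\sqrt{nm}}{\varepsilon^2},\ \frac{n^{2/3}m^{1/3}\alpha^{1/3}}{\varepsilon^{4/3}}\right\}$$ samples. -/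

import Mathlib

noncomputable section

/-! ### Randomized algorithms with sample access -/

/-- A randomized, adaptive algorithm with output in `R` that has sample access to a family, indexed
by `ι`, of unknown distributions on `X`. It may output a value, draw a fresh independent sample from
the `i`-th unknown distribution, or use internal randomness from a known distribution. -/
inductive SampleProg (ι X R : Type) : Type 1
  | ret (r : R) : SampleProg ι X R
  | draw (i : ι) (k : X → SampleProg ι X R) : SampleProg ι X R
  | toss {A : Type} (q : PMF A) (k : A → SampleProg ι X R) : SampleProg ι X R

namespace SampleProg

variable {ι κ X Y R S : Type}

/-- Run the first algorithm and feed its output to the second one. -/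
def bind : SampleProg ι X R → (R → SampleProg ι X S) → SampleProg ι X S
  | ret r, f => f r
  | draw i k, f => draw i fun x => (k x).bind f
  | toss q k, f => toss q fun a => (k a).bind f

instance : Monad (SampleProg ι X) where
  pure := ret
  bind := bind

/-- The law of the output when the unknown distributions are `p i`. -/
def run (p : ι → PMF X) : SampleProg ι X R → PMF R
  | ret r => PMF.pure r
  | draw i k => (p i).bind fun x => (k x).run p
  | toss q k => q.bind fun a => (k a).run p

/-- The worst-case number of samples drawn, over all values of the samples and all possible values
of the internal randomness. -/
def maxSamples : SampleProg ι X R → ℕ∞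
  | ret _ => 0
  | draw _ k => (⨆ x, (k x).maxSamples) + 1
  | toss q k => ⨆ a ∈ q.support, (k a).maxSamples

/-- The algorithm never draws more than `B` samples. -/
def UsesAtMost (P : SampleProg ι X R) (B : ℝ) : Prop :=
  ∃ k : ℕ, P.maxSamples ≤ k ∧ (k : ℝ) ≤ B

/-- One sample from the `i`-th unknown distribution. -/
def sample (i : ι) : SampleProg ι X X := draw i ret

/-- `k` independent samples from the `i`-th unknown distribution. -/
def samples (i : ι) : ℕ → SampleProg ι X (List X)
  | 0 => ret []
  | k + 1 => do
    let x ← sample i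
    let xs ← samples i k
    return x :: xs

/-- One draw from the known distribution `q`. -/
def random (q : PMF R) : SampleProg ι X R := toss q ret

/-- Run an algorithm on distributions on `Y`, where `h i` is the procedure that generates one sample
of the `i`-th of them. -/
def simulate (h : κ → SampleProg ι X Y) : SampleProg κ Y R → SampleProg ι X R
  | ret r => ret r
  | draw i k => (h i).bind fun y => simulate h (k y)
  | toss q k => toss q fun a => simulate h (k a)

end SampleProg

open SampleProg

/-! ### Discrete distributions -/

/-- Total variation distance of two distributions on a finite set. -/
def tvDist {X : Type} [Fintype X] (p q : PMF X) : ℝ :=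
  (1 / 2) * ∑ x, |(p x).toReal - (q x).toReal|

/-- The squared `ℓ₂`-norm of a distribution on a finite set. -/
def l2NormSq {X : Type} [Fintype X] (p : PMF X) : ℝ :=
  ∑ x, (p x).toReal ^ 2

/-- Product distributions on `[n] × [m]`. -/
def IsProductDist {n m : ℕ} (p : PMF (Fin n × Fin m)) : Prop :=
  ∃ (q : PMF (Fin n)) (r : PMF (Fin m)), ∀ i j, p (i, j) = q i * r j

/-- `p` is `ε`-far from every product distribution. -/
def IsFarFromProduct {n m : ℕ} (ε : ℝ) (p : PMF (Fin n × Fin m)) : Prop :=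
  ∀ q : PMF (Fin n × Fin m), IsProductDist q → ε ≤ tvDist p q

/-! ### The two subroutines -/

/-- `E N δ` estimates the squared `ℓ₂`-norm of an unknown distribution on `[N]` within a factor
`1 ± 1/2`, with failure probability at most `δ`, from `O(√N log (1/δ))` samples. -/
def IsL2NormEstimator (E : (N : ℕ) → (δ : ℝ) → SampleProg Unit (Fin N) ℝ) : Prop :=
  ∃ C : ℝ, 0 < C ∧ ∀ (N : ℕ) (δ : ℝ), 0 < δ → δ ≤ 1 / 2 →
    (E N δ).UsesAtMost (C * (√N * Real.log (1 / δ))) ∧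
    ∀ p : PMF (Fin N),
      1 - δ ≤ (((E N δ).run fun _ => p).toOuterMeasure
        {L | l2NormSq p / 2 ≤ L ∧ L ≤ 3 * l2NormSq p / 2}).toReal

/-- `T N b ε δ` has sample access to two unknown distributions `p` (index `false`) and `q` (index
`true`) on `[N]`. If `b ≥ min (‖p‖₂²) (‖q‖₂²)`, it distinguishes `p = q` (output `true`) from
`TV(p, q) ≥ ε` (output `false`) with failure probability at most `δ`; it uses
`O(N √b / ε² · log (1/δ))` samples. -/
def IsClosenessTester (T : (N : ℕ) → (b ε δ : ℝ) → SampleProg Bool (Fin N) Bool) : Prop :=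
  ∃ C : ℝ, 0 < C ∧ ∀ (N : ℕ) (b ε δ : ℝ), 0 < b → 0 < ε → ε < 1 → 0 < δ → δ ≤ 1 / 2 →
    (T N b ε δ).UsesAtMost (C * (N * √b / ε ^ 2 * Real.log (1 / δ))) ∧
    ∀ p q : PMF (Fin N), min (l2NormSq p) (l2NormSq q) ≤ b →
      (p = q → 1 - δ ≤ (((T N b ε δ).run fun i => bif i then q else p) true).toReal) ∧
      (ε ≤ tvDist p q → 1 - δ ≤ (((T N b ε δ).run fun i => bif i then q else p) false).toReal)

/-! ### Augmented flattening -/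

/-- The number of buckets `⌊n q(i)⌋ + N_i + 1` of each `i ∈ [n]`, where `q` is the prediction and
`N_i` is the frequency of `i` among the samples. -/
def buckets {n : ℕ} (q : PMF (Fin n)) (samp : List (Fin n)) (i : Fin n) : ℕ :=
  ⌊(n : ℝ) * (q i).toReal⌋₊ + samp.count i + 1

instance {n : ℕ} (q : PMF (Fin n)) (samp : List (Fin n)) (i : Fin n) :
    NeZero (buckets q samp i) :=
  ⟨Nat.succ_ne_zero _⟩

/-- Send `i ∈ [n]` to a uniformly random one of its `b i` buckets. The flattened domain, the
disjoint union of the sets of buckets, is identified with `[∑ i, b i]`. -/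
def flattenPoint {ι X : Type} {n : ℕ} (b : Fin n → ℕ) [∀ i, NeZero (b i)] (i : Fin n) :
    SampleProg ι X (Fin (∑ i, b i)) := do
  let k ← random (PMF.uniformOfFintype (Fin (b i)))
  return finSigmaFinEquiv ⟨i, k⟩

section FlatSamples

variable {n m : ℕ} (b₁ : Fin n → ℕ) (b₂ : Fin m → ℕ) [∀ i, NeZero (b₁ i)] [∀ j, NeZero (b₂ j)]

/-- A sample from the flattened first marginal. -/
def flatSample₁ : SampleProg Unit (Fin n × Fin m) (Fin (∑ i, b₁ i)) := do
  let x ← sample ()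
  flattenPoint b₁ x.1

/-- A sample from the flattened second marginal. -/
def flatSample₂ : SampleProg Unit (Fin n × Fin m) (Fin (∑ j, b₂ j)) := do
  let x ← sample ()
  flattenPoint b₂ x.2

/-- A sample from the flattened joint distribution. -/
def flatSampleJoint :
    SampleProg Unit (Fin n × Fin m) (Fin ((∑ i, b₁ i) * ∑ j, b₂ j)) := do
  let x ← sample ()
  let u ← flattenPoint b₁ x.1
  let v ← flattenPoint b₂ x.2
  return finProdFinEquiv (u, v)

/-- A sample from the product of the flattened marginals. -/
def flatSampleProd :
    SampleProg Unit (Fin n × Fin m) (Fin ((∑ i, b₁ i) * ∑ j, b₂ j)) := do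
  let u ← flatSample₁ b₁
  let v ← flatSample₂ b₂
  return finProdFinEquiv (u, v)

end FlatSamples

/-! ### The augmented independence tester -/

/-- The three possible outputs. -/
inductive Verdict
  | accept
  | reject
  | inaccurate

/-- The part of the tester that follows the construction of the flattening, with `c = 120`. -/
def flattenedTest (E : (N : ℕ) → (δ : ℝ) → SampleProg Unit (Fin N) ℝ)
    (T : (N : ℕ) → (b ε δ : ℝ) → SampleProg Bool (Fin N) Bool)
    {n m : ℕ} (b₁ : Fin n → ℕ) (b₂ : Fin m → ℕ) [∀ i, NeZero (b₁ i)] [∀ j, NeZero (b₂ j)]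
    (τ₁ τ₂ ε : ℝ) : SampleProg Unit (Fin n × Fin m) Verdict := do
  let L₁ ← simulate (fun _ => flatSample₁ b₁) (E (∑ i, b₁ i) (1 / 120))
  let L₂ ← simulate (fun _ => flatSample₂ b₂) (E (∑ j, b₂ j) (1 / 120))
  if L₁ > 120 * τ₁ ∨ L₂ > 120 * τ₂ then
    return Verdict.inaccurate
  else
    let L ← simulate (fun _ => flatSampleJoint b₁ b₂) (E ((∑ i, b₁ i) * ∑ j, b₂ j) (1 / 120))
    if L > 10 * 120 ^ 2 * τ₁ * τ₂ then
      return Verdict.reject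
    else
      let closeEnough ← simulate
        (fun i => bif i then flatSampleProd b₁ b₂ else flatSampleJoint b₁ b₂)
        (T ((∑ i, b₁ i) * ∑ j, b₂ j) (4 * 120 ^ 2 * τ₁ * τ₂) ε (1 / 80))
      return (bif closeEnough then Verdict.accept else Verdict.reject)

/-- The Poisson distribution with mean `s ≥ 0`. -/
def poisson (s : ℝ) : PMF ℕ :=
  (ProbabilityTheory.poissonMeasure s.toNNReal).toPMF

/-- The augmented independence tester on `[n] × [m]` with prediction `phat`, suggested prediction
error `α` and proximity parameter `ε`, built from the norm estimator `E` and the closeness tester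
`T`; the constants are `c = 120` and `c' = 160`. For `α = 0` one has `s₁ = s₂ = 0`, and the terms
`2 * α / s₁` and `2 * α / s₂` are `0`. -/
def augIndependenceTester (E : (N : ℕ) → (δ : ℝ) → SampleProg Unit (Fin N) ℝ)
    (T : (N : ℕ) → (b ε δ : ℝ) → SampleProg Bool (Fin N) Bool)
    (n m : ℕ) (α ε : ℝ) (phat : PMF (Fin n × Fin m)) :
    SampleProg Unit (Fin n × Fin m) Verdict := do
  let s₁ : ℝ := min ((n : ℝ) ^ (2 / 3 : ℝ) * (m : ℝ) ^ (1 / 3 : ℝ) * α ^ (1 / 3 : ℝ)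
    * ε ^ (-4 / 3 : ℝ)) (n * α)
  let s₂ : ℝ := m * α
  let t₁ ← random (poisson s₁)
  let t₂ ← random (poisson s₂)
  if (t₁ : ℝ) > 160 * s₁ ∨ (t₂ : ℝ) > 160 * s₂ then
    return Verdict.reject
  else
    let S₁ ← samples () t₁
    let S₂ ← samples () t₂
    flattenedTest E T (buckets (phat.map Prod.fst) (S₁.map Prod.fst))
      (buckets (phat.map Prod.snd) (S₂.map Prod.snd))
      (2 * α / s₁ + 4 / n) (2 * α / s₂ + 4 / m) ε

/-- `A` is an `(α, ε, δ)`-augmented independence tester on `[n] × [m]`: for every unknown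
distribution `p` and every prediction `phat`, each of the three errors has probability at most
`δ / 2`. -/
def IsAugIndependenceTester {n m : ℕ} (α ε δ : ℝ)
    (A : (phat : PMF (Fin n × Fin m)) → SampleProg Unit (Fin n × Fin m) Verdict) : Prop :=
  ∀ p phat : PMF (Fin n × Fin m),
    (IsProductDist p → (((A phat).run fun _ => p) Verdict.reject).toReal ≤ δ / 2) ∧
    (IsFarFromProduct ε p → (((A phat).run fun _ => p) Verdict.accept).toReal ≤ δ / 2) ∧
    (tvDist p phat ≤ α → (((A phat).run fun _ => p) Verdict.inaccurate).toReal ≤ δ / 2)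

/-!
Flattening preserves total variation distances and commutes with products, so independence may be
tested after it. Splitting `i` into `⌊n q i⌋ + 1` buckets plus one per Poisson sample equal to `i`
makes the expected squared norm of the flattened `p` at most `2 α / s + 4 / n` when `q` is `α`-close
to `p`: if `p i ≤ 2 q i`, the prediction alone bounds the term `p i ^ 2 / b i` by `2 p i / n`;
otherwise the samples bound its expectation by `p i / s`, and such `i` have total mass at most
`2 α`. By Markov's inequality an accurate prediction therefore passes both norm checks, and whenever
they are passed the closeness tester runs under its norm promise. The norm of the flattened joint
distribution is checked only to refute independence: for a product distribution it is the product of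
the two marginal norms.

Both subroutines evaluate a bilinear statistic of two independent groups of samples, controlled by
Chebyshev's inequality, and amplify by a median or a majority.
-/

open scoped ENNReal

noncomputable section

section Expectation

variable {Ω Ω₂ : Type*}

/-- The expectation of a nonnegative function under a discrete law, as a sum over atoms: unlike the
Lebesgue integral against `PMF.toMeasure`, it does not need a `σ`-algebra. -/
def expect (μ : PMF Ω) (f : Ω → ℝ≥0∞) : ℝ≥0∞ := ∑' x, μ x * f x

theorem expect_pure (a : Ω) (f : Ω → ℝ≥0∞) : expect (PMF.pure a) f = f a := by
  unfold expect
  rw [tsum_eq_single a fun b hb => by simp [PMF.pure_apply, hb]]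
  simp

theorem expect_bind (μ : PMF Ω) (g : Ω → PMF Ω₂) (f : Ω₂ → ℝ≥0∞) :
    expect (μ.bind g) f = expect μ fun x => expect (g x) f := by
  simp only [expect, PMF.bind_apply, ← ENNReal.tsum_mul_right, ← ENNReal.tsum_mul_left]
  rw [ENNReal.tsum_comm]
  simp only [mul_assoc]

theorem expect_map (μ : PMF Ω) (g : Ω → Ω₂) (f : Ω₂ → ℝ≥0∞) :
    expect (μ.map g) f = expect μ (f ∘ g) := by
  simp only [PMF.map, expect_bind, expect_pure, Function.comp_def]

theorem expect_mono (μ : PMF Ω) {f g : Ω → ℝ≥0∞} (h : ∀ x, f x ≤ g x) : expect μ f ≤ expect μ g :=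
  ENNReal.tsum_le_tsum fun x => mul_le_mul_right (h x) _

theorem expect_const (μ : PMF Ω) (c : ℝ≥0∞) : (expect μ fun _ => c) = c := by
  simp only [expect, ENNReal.tsum_mul_right, μ.tsum_coe, one_mul]

theorem expect_add (μ : PMF Ω) (f g : Ω → ℝ≥0∞) :
    (expect μ fun x => f x + g x) = expect μ f + expect μ g := by
  simp only [expect, mul_add, ENNReal.tsum_add]

theorem expect_const_mul (μ : PMF Ω) (c : ℝ≥0∞) (f : Ω → ℝ≥0∞) :
    (expect μ fun x => c * f x) = c * expect μ f := by
  simp only [expect, ← ENNReal.tsum_mul_left, mul_left_comm]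

theorem expect_mul_const (μ : PMF Ω) (c : ℝ≥0∞) (f : Ω → ℝ≥0∞) :
    (expect μ fun x => f x * c) = expect μ f * c := by
  simp only [mul_comm _ c, expect_const_mul]

theorem expect_finset_sum {ι : Type*} (μ : PMF Ω) (s : Finset ι) (f : ι → Ω → ℝ≥0∞) :
    (expect μ fun x => ∑ i ∈ s, f i x) = ∑ i ∈ s, expect μ (f i) := by
  simp only [expect, Finset.mul_sum]
  exact Summable.tsum_finsetSum fun _ _ => ENNReal.summable

theorem expect_comm (μ : PMF Ω) (ν : PMF Ω₂) (f : Ω → Ω₂ → ℝ≥0∞) :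
    (expect μ fun x => expect ν (f x)) = expect ν fun y => expect μ fun x => f x y := by
  simp only [expect, ← ENNReal.tsum_mul_left, mul_left_comm]
  exact ENNReal.tsum_comm

theorem expect_le_of_le (μ : PMF Ω) {f : Ω → ℝ≥0∞} {c : ℝ≥0∞} (h : ∀ x, f x ≤ c) :
    expect μ f ≤ c :=
  (expect_mono μ h).trans_eq (expect_const μ c)

/-- The probability of an event, as a real number. -/
def prob (μ : PMF Ω) (S : Set Ω) : ℝ := (μ.toOuterMeasure S).toReal

theorem prob_nonneg (μ : PMF Ω) (S : Set Ω) : 0 ≤ prob μ S := ENNReal.toReal_nonneg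

theorem ofReal_prob (μ : PMF Ω) (S : Set Ω) :
    ENNReal.ofReal (prob μ S) = expect μ (S.indicator 1) := by
  have h : μ.toOuterMeasure S = expect μ (S.indicator 1) := by
    rw [PMF.toOuterMeasure_apply]
    refine tsum_congr fun x => ?_
    by_cases hx : x ∈ S <;> simp [hx]
  have h_le : expect μ (S.indicator 1) ≤ 1 :=
    expect_le_of_le μ fun x => Set.indicator_le_self' (fun _ _ => zero_le) x
  rw [prob, h, ENNReal.ofReal_toReal (ne_top_of_le_ne_top ENNReal.one_ne_top h_le)]

theorem prob_add_prob_compl (μ : PMF Ω) (S : Set Ω) : prob μ S + prob μ Sᶜ = 1 := by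
  have h : expect μ (S.indicator 1) + expect μ (Sᶜ.indicator 1) = 1 := by
    rw [← expect_add, ← expect_const μ 1]
    congr 1
    ext x
    by_cases hx : x ∈ S <;> simp [hx]
  rw [← ofReal_prob, ← ofReal_prob, ← ENNReal.ofReal_add (prob_nonneg μ S) (prob_nonneg μ Sᶜ)] at h
  exact ENNReal.ofReal_eq_one.1 h

theorem prob_le_one (μ : PMF Ω) (S : Set Ω) : prob μ S ≤ 1 := by
  linarith [prob_add_prob_compl μ S, prob_nonneg μ Sᶜ]

theorem prob_mono (μ : PMF Ω) {S U : Set Ω} (h : S ⊆ U) : prob μ S ≤ prob μ U := by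
  rw [← ENNReal.ofReal_le_ofReal_iff (prob_nonneg μ U), ofReal_prob, ofReal_prob]
  exact expect_mono μ (Set.indicator_le_indicator_of_subset h fun _ => zero_le)

theorem prob_singleton (μ : PMF Ω) (a : Ω) : prob μ {a} = (μ a).toReal := by
  rw [prob, PMF.toOuterMeasure_apply_singleton]

theorem prob_map (μ : PMF Ω) (g : Ω → Ω₂) (S : Set Ω₂) : prob (μ.map g) S = prob μ (g ⁻¹' S) := by
  rw [prob, PMF.toOuterMeasure_map_apply, prob]

theorem toReal_map_apply_of_injective {g : Ω → Ω₂} (hg : g.Injective) (μ : PMF Ω) (x : Ω) :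
    (μ.map g (g x)).toReal = (μ x).toReal := by
  rw [← prob_singleton, prob_map, ← Set.image_singleton, hg.preimage_image, prob_singleton]

theorem prob_pure_of_notMem {a : Ω} {S : Set Ω} (h : a ∉ S) : prob (PMF.pure a) S = 0 := by
  rw [prob, PMF.toOuterMeasure_pure_apply, if_neg h, ENNReal.toReal_zero]

theorem ofReal_prob_bind (μ : PMF Ω) (g : Ω → PMF Ω₂) (S : Set Ω₂) :
    ENNReal.ofReal (prob (μ.bind g) S) = expect μ fun x => ENNReal.ofReal (prob (g x) S) := by
  simp only [ofReal_prob, expect_bind]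

theorem prob_bind_le_add (μ : PMF Ω) {g : Ω → PMF Ω₂} {S : Set Ω} {U : Set Ω₂} {c : ℝ} (hc : 0 ≤ c)
    (h : ∀ x ∉ S, prob (g x) U ≤ c) : prob (μ.bind g) U ≤ prob μ S + c := by
  have hμS := prob_nonneg μ S
  rw [← ENNReal.ofReal_le_ofReal_iff (by positivity), ofReal_prob_bind, ENNReal.ofReal_add hμS hc,
    ofReal_prob, ← expect_const μ (ENNReal.ofReal c), ← expect_add]
  refine expect_mono μ fun x => ?_
  by_cases hx : x ∈ S
  · calc ENNReal.ofReal (prob (g x) U) ≤ 1 := ENNReal.ofReal_le_one.2 (prob_le_one _ _)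
      _ ≤ S.indicator 1 x + ENNReal.ofReal c := by simp [hx]
  · simpa [hx] using ENNReal.ofReal_le_ofReal (h x hx)

theorem prob_bind_le (μ : PMF Ω) {g : Ω → PMF Ω₂} {U : Set Ω₂} {c : ℝ} (hc : 0 ≤ c)
    (h : ∀ x, prob (g x) U ≤ c) : prob (μ.bind g) U ≤ c := by
  rw [← ENNReal.ofReal_le_ofReal_iff hc, ofReal_prob_bind]
  exact expect_le_of_le μ fun x => ENNReal.ofReal_le_ofReal (h x)

theorem prob_le_div_of_expect_le (μ : PMF Ω) {f : Ω → ℝ≥0∞} {S : Set Ω} {c M : ℝ} (hc : 0 < c)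
    (hM : 0 ≤ M) (hS : ∀ x ∈ S, ENNReal.ofReal c ≤ f x) (hf : expect μ f ≤ ENNReal.ofReal M) :
    prob μ S ≤ M / c := by
  rw [le_div_iff₀ hc, ← ENNReal.ofReal_le_ofReal_iff hM, mul_comm, ENNReal.ofReal_mul hc.le,
    ofReal_prob, ← expect_const_mul]
  refine (expect_mono μ fun x => ?_).trans hf
  by_cases hx : x ∈ S
  · simpa [hx] using hS x hx
  · simp [hx]

end Expectation

section Mean

variable {Ω Ω₂ : Type*} [Fintype Ω]

theorem sum_toReal_eq_one (μ : PMF Ω) : ∑ x, (μ x).toReal = 1 := by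
  rw [← ENNReal.toReal_sum fun x _ => μ.apply_ne_top x, ← tsum_fintype (L := .unconditional _),
    μ.tsum_coe, ENNReal.toReal_one]

/-- The expectation of a real function on a finite set. -/
def mean (μ : PMF Ω) (f : Ω → ℝ) : ℝ := ∑ x, (μ x).toReal * f x

theorem mean_add (μ : PMF Ω) (f g : Ω → ℝ) : (mean μ fun x => f x + g x) = mean μ f + mean μ g := by
  simp only [mean, mul_add, Finset.sum_add_distrib]

theorem mean_const_mul (μ : PMF Ω) (c : ℝ) (f : Ω → ℝ) :
    (mean μ fun x => c * f x) = c * mean μ f := by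
  simp only [mean, Finset.mul_sum, mul_left_comm]

theorem mean_sub (μ : PMF Ω) (f g : Ω → ℝ) : (mean μ fun x => f x - g x) = mean μ f - mean μ g := by
  simp only [mean, mul_sub, Finset.sum_sub_distrib]

theorem mean_const (μ : PMF Ω) (c : ℝ) : (mean μ fun _ => c) = c := by
  rw [mean, ← Finset.sum_mul, sum_toReal_eq_one, one_mul]

theorem mean_finset_sum {ι : Type*} (μ : PMF Ω) (s : Finset ι) (f : ι → Ω → ℝ) :
    (mean μ fun x => ∑ i ∈ s, f i x) = ∑ i ∈ s, mean μ (f i) := by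
  simp only [mean, Finset.mul_sum]
  exact Finset.sum_comm

theorem mean_mono (μ : PMF Ω) {f g : Ω → ℝ} (h : ∀ x, f x ≤ g x) : mean μ f ≤ mean μ g :=
  Finset.sum_le_sum fun x _ => mul_le_mul_of_nonneg_left (h x) ENNReal.toReal_nonneg

theorem mean_nonneg (μ : PMF Ω) {f : Ω → ℝ} (h : ∀ x, 0 ≤ f x) : 0 ≤ mean μ f :=
  Finset.sum_nonneg fun x _ => mul_nonneg ENNReal.toReal_nonneg (h x)

theorem expect_ofReal (μ : PMF Ω) {f : Ω → ℝ} (hf : ∀ x, 0 ≤ f x) :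
    (expect μ fun x => ENNReal.ofReal (f x)) = ENNReal.ofReal (mean μ f) := by
  unfold expect mean
  rw [tsum_fintype, ENNReal.ofReal_sum_of_nonneg fun x _ => mul_nonneg ENNReal.toReal_nonneg (hf x)]
  refine Finset.sum_congr rfl fun x _ => ?_
  rw [ENNReal.ofReal_mul ENNReal.toReal_nonneg, ENNReal.ofReal_toReal (μ.apply_ne_top x)]

theorem toReal_bind_apply (μ : PMF Ω) (g : Ω → PMF Ω₂) (y : Ω₂) :
    (μ.bind g y).toReal = mean μ fun x => (g x y).toReal := by
  rw [PMF.bind_apply, tsum_fintype,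
    ENNReal.toReal_sum fun x _ => ENNReal.mul_ne_top (μ.apply_ne_top x) ((g x).apply_ne_top y)]
  simp only [ENNReal.toReal_mul, mean]

variable [Fintype Ω₂]

theorem mean_comm (μ : PMF Ω) (ν : PMF Ω₂) (f : Ω → Ω₂ → ℝ) :
    (mean μ fun x => mean ν (f x)) = mean ν fun y => mean μ fun x => f x y := by
  simp only [mean, Finset.mul_sum]
  rw [Finset.sum_comm]
  simp only [mul_left_comm]

theorem mean_bind (μ : PMF Ω) (g : Ω → PMF Ω₂) (f : Ω₂ → ℝ) :
    mean (μ.bind g) f = mean μ fun x => mean (g x) f := by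
  simp only [mean, toReal_bind_apply, Finset.sum_mul, Finset.mul_sum, mul_assoc]
  exact Finset.sum_comm

theorem mean_pure (a : Ω) (f : Ω → ℝ) : mean (PMF.pure a) f = f a := by
  classical
  simp [mean, PMF.pure_apply, apply_ite ENNReal.toReal]

theorem mean_map (μ : PMF Ω) (g : Ω → Ω₂) (f : Ω₂ → ℝ) :
    mean (μ.map g) f = mean μ fun x => f (g x) := by
  simp only [PMF.map, mean_bind, Function.comp_apply, mean_pure]

end Mean

section Iid

variable {Ω : Type*}

/-- The law of `k` independent samples from `μ`. -/
def iid (μ : PMF Ω) : (k : ℕ) → PMF (Fin k → Ω)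
  | 0 => PMF.pure Fin.elim0
  | k + 1 => μ.bind fun x => (iid μ k).map (Fin.cons x)

theorem expect_iid_succ (μ : PMF Ω) (k : ℕ) (f : (Fin (k + 1) → Ω) → ℝ≥0∞) :
    expect (iid μ (k + 1)) f = expect μ fun x => expect (iid μ k) fun v => f (Fin.cons x v) := by
  simp only [iid, expect_bind, expect_map, Function.comp_def]

theorem expect_iid_prod (μ : PMF Ω) (k : ℕ) (g : Ω → ℝ≥0∞) :
    (expect (iid μ k) fun v => ∏ j, g (v j)) = expect μ g ^ k := by
  induction k with
  | zero => simp only [Finset.univ_eq_empty, Finset.prod_empty, expect_const, pow_zero]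
  | succ k ih =>
    simp only [expect_iid_succ, Fin.prod_univ_succ, Fin.cons_zero, Fin.cons_succ, expect_const_mul,
      ih, expect_mul_const, pow_succ']

/-- A Chernoff bound, from the moment generating function of the number of occurrences. -/
theorem prob_iid_half_le_card_le (μ : PMF Ω) {S : Set Ω} (hS : prob μ S ≤ 1 / 16) (k : ℕ) :
    prob (iid μ k) {v | k ≤ 2 * (v ⁻¹' S).ncard} ≤ (1 / 2) ^ k := by
  classical
  have h_mgf : expect μ (fun x => if x ∈ S then 16 else 1) ≤ ENNReal.ofReal 2 := by
    calc expect μ (fun x => if x ∈ S then 16 else 1)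
        ≤ expect μ fun x => 1 + 16 * S.indicator 1 x :=
          expect_mono μ fun x => by by_cases hx : x ∈ S <;> simp [hx]
      _ = ENNReal.ofReal (1 + 16 * prob μ S) := by
          rw [expect_add, expect_const, expect_const_mul, ← ofReal_prob,
            ENNReal.ofReal_add zero_le_one (mul_nonneg (by norm_num) (prob_nonneg μ S)),
            ENNReal.ofReal_mul (by norm_num), ENNReal.ofReal_one, ENNReal.ofReal_ofNat]
      _ ≤ ENNReal.ofReal 2 := ENNReal.ofReal_le_ofReal (by linarith)
  have h_markov : prob (iid μ k) {v | k ≤ 2 * (v ⁻¹' S).ncard} ≤ 2 ^ k / 4 ^ k := by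
    refine prob_le_div_of_expect_le (iid μ k) (f := fun v => ∏ j, if v j ∈ S then 16 else 1)
      (by positivity) (by positivity) (fun v hv => ?_) ?_
    · have h_card : (Finset.univ.filter fun j => v j ∈ S).card = (v ⁻¹' S).ncard := by
        rw [Set.ncard_eq_toFinset_card']
        congr 1
        ext j
        simp
      rw [Finset.prod_ite, Finset.prod_const, Finset.prod_const_one, mul_one, h_card,
        show (16 : ℝ≥0∞) = 4 ^ 2 by norm_num, ← pow_mul,
        ENNReal.ofReal_pow (by norm_num), ENNReal.ofReal_ofNat]
      exact pow_le_pow_right₀ (by norm_num) hv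
    · rw [expect_iid_prod μ k fun x => if x ∈ S then 16 else 1, ENNReal.ofReal_pow (by norm_num)]
      gcongr
  rwa [← div_pow, show (2 / 4 : ℝ) = 1 / 2 by norm_num] at h_markov

variable [Fintype Ω]

theorem mean_iid_succ (μ : PMF Ω) (k : ℕ) (f : (Fin (k + 1) → Ω) → ℝ) :
    mean (iid μ (k + 1)) f = mean μ fun x => mean (iid μ k) fun v => f (Fin.cons x v) := by
  simp only [iid, mean_bind, mean_map]

theorem mean_iid_sum (μ : PMF Ω) (k : ℕ) (g : Ω → ℝ) :
    (mean (iid μ k) fun v => ∑ j, g (v j)) = k * mean μ g := by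
  induction k with
  | zero => simp only [Finset.univ_eq_empty, Finset.sum_empty, mean_const, Nat.cast_zero, zero_mul]
  | succ k ih =>
    simp only [mean_iid_succ, Fin.sum_univ_succ, Fin.cons_zero, Fin.cons_succ, mean_add, mean_const,
      ih]
    push_cast
    ring

theorem mean_iid_sum_sq (μ : PMF Ω) (k : ℕ) (g : Ω → ℝ) :
    (mean (iid μ k) fun v => (∑ j, g (v j)) ^ 2)
      = k * (mean μ fun x => g x ^ 2) + k * (k - 1) * mean μ g ^ 2 := by
  induction k with
  | zero => simp [mean_const]
  | succ k ih =>
    have h_sq : ∀ (x : Ω) (v : Fin k → Ω), (g x + ∑ j, g (v j)) ^ 2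
        = g x ^ 2 + (2 * g x * ∑ j, g (v j) + (∑ j, g (v j)) ^ 2) := fun x v => by ring
    have h_cross : ∀ x, 2 * g x * (k * mean μ g) = 2 * (k * mean μ g) * g x := fun x => by ring
    simp only [mean_iid_succ, Fin.sum_univ_succ, Fin.cons_zero, Fin.cons_succ, h_sq, mean_add,
      mean_const, mean_const_mul, mean_iid_sum, ih, h_cross]
    push_cast
    ring

theorem mean_iid_bilinear (μ : PMF Ω) (h : Ω → Ω → ℝ) (k : ℕ) :
    (mean (iid μ k) fun v => mean (iid μ k) fun w => ∑ j, ∑ i, h (v i) (w j))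
      = k ^ 2 * mean μ fun a => mean μ (h a) := by
  have h_row : ∀ v : Fin k → Ω, (mean (iid μ k) fun w => ∑ j, ∑ i, h (v i) (w j))
      = k * ∑ i, mean μ (h (v i)) := fun v => by
    rw [mean_iid_sum μ k fun b => ∑ i, h (v i) b, mean_finset_sum]
  simp only [h_row, mean_const_mul]
  rw [mean_iid_sum μ k fun a => mean μ (h a), sq, mul_assoc]

theorem mean_iid_bilinear_sq (μ : PMF Ω) {h : Ω → Ω → ℝ} (h_symm : ∀ a b, h a b = h b a) (k : ℕ) :
    (mean (iid μ k) fun v => mean (iid μ k) fun w => (∑ j, ∑ i, h (v i) (w j)) ^ 2)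
      = k ^ 2 * (mean μ fun a => mean μ fun b => h a b ^ 2)
        + 2 * k ^ 2 * (k - 1) * (mean μ fun a => mean μ (h a) ^ 2)
        + k ^ 2 * (k - 1) ^ 2 * (mean μ fun a => mean μ (h a)) ^ 2 := by
  have h_row : ∀ v : Fin k → Ω, (mean (iid μ k) fun w => (∑ j, ∑ i, h (v i) (w j)) ^ 2)
      = k * (mean μ fun b => (∑ i, h (v i) b) ^ 2)
        + k * (k - 1) * (∑ i, mean μ (h (v i))) ^ 2 := fun v => by
    rw [mean_iid_sum_sq μ k fun b => ∑ i, h (v i) b, mean_finset_sum]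
  have h_column : ∀ b, (mean (iid μ k) fun v => (∑ i, h (v i) b) ^ 2)
      = k * (mean μ fun a => h b a ^ 2) + k * (k - 1) * mean μ (h b) ^ 2 := fun b => by
    rw [mean_iid_sum_sq μ k fun a => h a b]
    simp only [h_symm _ b]
  simp only [h_row, mean_add, mean_const_mul]
  rw [mean_comm, mean_iid_sum_sq μ k fun a => mean μ (h a)]
  simp only [h_column, mean_add, mean_const_mul]
  ring

theorem mean_iid_bilinear_sub_sq_le (μ : PMF Ω) {h : Ω → Ω → ℝ} (h_symm : ∀ a b, h a b = h b a)
    (k : ℕ) :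
    (mean (iid μ k) fun v => mean (iid μ k) fun w =>
        ((∑ j, ∑ i, h (v i) (w j)) - k ^ 2 * mean μ fun a => mean μ (h a)) ^ 2)
      ≤ k ^ 2 * (mean μ fun a => mean μ fun b => h a b ^ 2)
        + 2 * k ^ 3 * (mean μ fun a => mean μ (h a) ^ 2) := by
  set D := mean μ fun a => mean μ (h a) with hD
  have h_expand : ∀ z : ℝ, (z - k ^ 2 * D) ^ 2 = z ^ 2 + (-2 * k ^ 2 * D * z + (k ^ 2 * D) ^ 2) :=
    fun z => by ring
  simp only [h_expand, mean_add, mean_const_mul, mean_const, mean_iid_bilinear,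
    mean_iid_bilinear_sq μ h_symm, ← hD]
  have h_var : 0 ≤ mean μ fun a => mean μ (h a) ^ 2 := mean_nonneg μ fun a => sq_nonneg _
  rcases Nat.eq_zero_or_pos k with rfl | hk
  · simp
  · have hk' : (1 : ℝ) ≤ k := by exact_mod_cast hk
    have h_mean : 0 ≤ (k : ℝ) ^ 2 * (2 * k - 1) * D ^ 2 :=
      mul_nonneg (mul_nonneg (by positivity) (by linarith)) (sq_nonneg D)
    nlinarith [mul_nonneg (sq_nonneg (k : ℝ)) h_var]

end Iid

namespace SampleProg

variable {ι κ X Y R S : Type}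

theorem pure_eq_ret (r : R) : (pure r : SampleProg ι X R) = ret r := rfl

theorem monad_bind_eq_bind (P : SampleProg ι X R) (f : R → SampleProg ι X S) :
    P >>= f = P.bind f := rfl

theorem run_ret (p : ι → PMF X) (r : R) : (ret r : SampleProg ι X R).run p = PMF.pure r := rfl

theorem run_bind (p : ι → PMF X) (P : SampleProg ι X R) (f : R → SampleProg ι X S) :
    (P.bind f).run p = (P.run p).bind fun r => (f r).run p := by
  induction P with
  | ret r => simp only [bind, run, PMF.pure_bind]
  | draw i k ih => simp only [bind, run, ih, PMF.bind_bind]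
  | toss q k ih => simp only [bind, run, ih, PMF.bind_bind]

theorem run_bind_ret (p : ι → PMF X) (P : SampleProg ι X R) (f : R → S) :
    (P.bind fun r => ret (f r)).run p = (P.run p).map f :=
  run_bind p P _

theorem run_sample (p : ι → PMF X) (i : ι) : (sample i).run p = p i := PMF.bind_pure _

theorem run_random (p : ι → PMF X) (q : PMF R) : (random q).run p = q := PMF.bind_pure _

theorem run_simulate (p : ι → PMF X) (h : κ → SampleProg ι X Y) (P : SampleProg κ Y R) :
    (simulate h P).run p = P.run fun i => (h i).run p := by
  induction P with
  | ret r => rfl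
  | draw i k ih => simp only [simulate, run, run_bind, ih]
  | toss q k ih => simp only [simulate, run, ih]

theorem run_samples (p : ι → PMF X) (i : ι) (k : ℕ) :
    (samples i k).run p = (iid (p i) k).map List.ofFn := by
  induction k with
  | zero => simp only [samples, run_ret, iid, PMF.pure_map, List.ofFn_zero]
  | succ k ih =>
    have ofFn_cons : ∀ x : X, List.ofFn ∘ Fin.cons x = (x :: ·) ∘ List.ofFn (n := k) := fun x =>
      funext fun v => List.ofFn_cons x v
    rw [samples, monad_bind_eq_bind, run_bind, run_sample]
    simp only [monad_bind_eq_bind, pure_eq_ret, run_bind_ret, ih, iid, PMF.map_bind, PMF.map_comp,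
      ofFn_cons]

/-- Run an algorithm `k` times and collect the outputs. -/
def repeated (P : SampleProg ι X R) : (k : ℕ) → SampleProg ι X (Fin k → R)
  | 0 => ret Fin.elim0
  | k + 1 => P.bind fun r => (repeated P k).bind fun v => ret (Fin.cons r v)

theorem run_repeated (p : ι → PMF X) (P : SampleProg ι X R) (k : ℕ) :
    (P.repeated k).run p = iid (P.run p) k := by
  induction k with
  | zero => rfl
  | succ k ih =>
    rw [repeated, run_bind]
    simp only [run_bind_ret, ih, iid]

theorem maxSamples_bind_le (P : SampleProg ι X R) {f : R → SampleProg ι X S} {b : ℕ∞}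
    (hf : ∀ r, (f r).maxSamples ≤ b) : (P.bind f).maxSamples ≤ P.maxSamples + b := by
  induction P with
  | ret r => simpa only [bind, maxSamples, zero_add] using hf r
  | draw i k ih =>
    rw [bind, maxSamples, maxSamples, add_right_comm]
    gcongr
    exact iSup_le fun x => (ih x).trans (by gcongr; exact le_iSup (fun x => (k x).maxSamples) x)
  | toss q k ih =>
    exact iSup₂_le fun a ha => (ih a).trans
      (by gcongr; exact le_iSup₂ (f := fun a (_ : a ∈ q.support) => (k a).maxSamples) a ha)

theorem maxSamples_simulate_le {h : κ → SampleProg ι X Y} (P : SampleProg κ Y R) {d : ℕ∞}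
    (hd : ∀ i, (h i).maxSamples ≤ d) : (simulate h P).maxSamples ≤ d * P.maxSamples := by
  induction P with
  | ret r => exact zero_le
  | draw i k ih =>
    calc ((h i).bind fun y => simulate h (k y)).maxSamples
        ≤ (h i).maxSamples + d * ⨆ x, (k x).maxSamples := maxSamples_bind_le _ fun y =>
          (ih y).trans (mul_le_mul_right (le_iSup (fun x => (k x).maxSamples) y) d)
      _ ≤ d + d * ⨆ x, (k x).maxSamples := by gcongr; exact hd i
      _ = d * (draw i k).maxSamples := by rw [maxSamples, mul_add, mul_one, add_comm]
  | toss q k ih =>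
    exact iSup₂_le fun a ha => (ih a).trans
      (by gcongr; exact le_iSup₂ (f := fun a (_ : a ∈ q.support) => (k a).maxSamples) a ha)

theorem maxSamples_samples_bind_le (i : ι) (k : ℕ) {f : List X → SampleProg ι X R} {b : ℕ∞}
    (hf : ∀ l, l.length = k → (f l).maxSamples ≤ b) :
    ((samples i k).bind f).maxSamples ≤ k + b := by
  induction k generalizing f with
  | zero => simpa only [samples, bind, Nat.cast_zero, zero_add] using hf [] rfl
  | succ k ih =>
    have bind_cons : ∀ (P : SampleProg ι X (List X)) (x : X),
        (P.bind fun l => ret (x :: l)).bind f = P.bind fun l => f (x :: l) := fun P x => by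
      induction P with
      | ret l => rfl
      | draw i k ih => simp only [bind, ih]
      | toss q k ih => simp only [bind, ih]
    have samples_succ_bind : (samples i (k + 1)).bind f
        = draw i fun x => (samples i k).bind fun l => f (x :: l) :=
      congrArg (draw i) (funext fun x => bind_cons (samples i k) x)
    rw [samples_succ_bind, maxSamples, Nat.cast_succ, add_right_comm]
    gcongr
    exact iSup_le fun x => ih fun l hl => hf _ (by rw [List.length_cons, hl])

namespace UsesAtMost

variable {P : SampleProg ι X R} {f : R → SampleProg ι X S} {a b : ℝ}

theorem nonneg (h : P.UsesAtMost a) : 0 ≤ a := by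
  obtain ⟨k, -, hka⟩ := h
  exact k.cast_nonneg.trans hka

theorem maxSamples_le_floor (h : P.UsesAtMost a) : P.maxSamples ≤ (⌊a⌋₊ : ℕ) := by
  obtain ⟨k, hk, hka⟩ := h
  exact hk.trans (Nat.cast_le.2 (Nat.le_floor hka))

theorem mono (h : P.UsesAtMost a) (hab : a ≤ b) : P.UsesAtMost b := by
  obtain ⟨k, hk, hka⟩ := h
  exact ⟨k, hk, hka.trans hab⟩

protected theorem ret (r : R) (ha : 0 ≤ a) : (ret r : SampleProg ι X R).UsesAtMost a :=
  ⟨0, zero_le, by rwa [Nat.cast_zero]⟩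

protected theorem sample (i : ι) : (sample i : SampleProg ι X X).UsesAtMost 1 :=
  ⟨1, by simp [SampleProg.sample, maxSamples], Nat.cast_one.le⟩

protected theorem bind (hP : P.UsesAtMost a) (hb : 0 ≤ b) (hf : ∀ r, (f r).UsesAtMost b) :
    (P.bind f).UsesAtMost (a + b) := by
  obtain ⟨k, hk, hka⟩ := hP
  refine ⟨k + ⌊b⌋₊, ?_, ?_⟩
  · push_cast
    exact (maxSamples_bind_le P fun r => (hf r).maxSamples_le_floor).trans (by gcongr)
  · push_cast
    exact add_le_add hka (Nat.floor_le hb)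

theorem bind_of_forall_zero (hP : P.UsesAtMost a) (hf : ∀ r, (f r).UsesAtMost 0) :
    (P.bind f).UsesAtMost a := by
  simpa only [add_zero] using hP.bind le_rfl hf

theorem bind_ret (hP : P.UsesAtMost a) (g : R → S) : (P.bind fun r => ret (g r)).UsesAtMost a :=
  hP.bind_of_forall_zero fun r => UsesAtMost.ret (g r) le_rfl

protected theorem random (q : PMF R) : (random q : SampleProg ι X R).UsesAtMost 0 :=
  ⟨0, iSup₂_le fun _ _ => zero_le, Nat.cast_zero.le⟩

theorem random_bind (q : PMF R) (hb : 0 ≤ b) (hf : ∀ r, (f r).UsesAtMost b) :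
    ((random q).bind f).UsesAtMost b := by
  simpa only [zero_add] using (UsesAtMost.random q).bind hb hf

protected theorem simulate {Q : SampleProg κ Y R} {h : κ → SampleProg ι X Y} {d : ℝ}
    (hQ : Q.UsesAtMost a) (hd : 0 ≤ d) (hh : ∀ i, (h i).UsesAtMost d) :
    (simulate h Q).UsesAtMost (d * a) := by
  obtain ⟨k, hk, hka⟩ := hQ
  refine ⟨⌊d⌋₊ * k, (maxSamples_simulate_le Q fun i => (hh i).maxSamples_le_floor).trans ?_, ?_⟩
  · push_cast
    gcongr
  · push_cast
    gcongr
    exact Nat.floor_le hd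

theorem samples_bind (i : ι) (k : ℕ) {f : List X → SampleProg ι X R} (hb : 0 ≤ b)
    (hf : ∀ l, l.length = k → (f l).UsesAtMost b) :
    ((samples i k).bind f).UsesAtMost (k + b) := by
  refine ⟨k + ⌊b⌋₊, ?_, ?_⟩
  · push_cast
    exact maxSamples_samples_bind_le i k fun l hl => (hf l hl).maxSamples_le_floor
  · push_cast
    exact add_le_add le_rfl (Nat.floor_le hb)

protected theorem repeated (hP : P.UsesAtMost a) (k : ℕ) : (P.repeated k).UsesAtMost (k * a) := by
  induction k with
  | zero => exact UsesAtMost.ret _ (by rw [Nat.cast_zero, zero_mul])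
  | succ k ih =>
    refine (hP.bind ih.nonneg fun r =>
      ih.bind_ret fun v => (Fin.cons r v : Fin (k + 1) → R)).mono (le_of_eq ?_)
    push_cast
    ring

end UsesAtMost

/-- The number of independent repetitions that reduces a failure probability `1 / 16` to `δ`. -/
def repetitions (δ : ℝ) : ℕ := ⌈Real.log (1 / δ) / Real.log 2⌉₊

theorem half_pow_repetitions_le {δ : ℝ} (hδ : 0 < δ) : (1 / 2 : ℝ) ^ repetitions δ ≤ δ := by
  have h_log : Real.log (1 / δ) ≤ Real.log (2 ^ repetitions δ) := by
    rw [Real.log_pow]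
    exact (div_le_iff₀ (Real.log_pos one_lt_two)).1 (Nat.le_ceil _)
  have h_le := (Real.log_le_log_iff (by positivity) (by positivity)).1 h_log
  rw [one_div] at h_le
  rw [one_div, inv_pow]
  exact (inv_le_comm₀ hδ (by positivity)).1 h_le

theorem repetitions_le {δ : ℝ} (hδ : 0 < δ) (hδ' : δ ≤ 1 / 2) :
    (repetitions δ : ℝ) ≤ 3 * Real.log (1 / δ) := by
  have h_two := Real.log_two_gt_d9
  have h_log : Real.log 2 ≤ Real.log (1 / δ) :=
    Real.log_le_log two_pos (by rw [le_div_iff₀ hδ]; linarith)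
  have h_ceil : (repetitions δ : ℝ) < Real.log (1 / δ) / Real.log 2 + 1 :=
    Nat.ceil_lt_add_one (div_nonneg (by linarith) (by linarith))
  have h_div : Real.log (1 / δ) / Real.log 2 ≤ 3 / 2 * Real.log (1 / δ) := by
    rw [div_le_iff₀ (by linarith)]
    nlinarith
  linarith

/-- Boost the success probability of `P` to `1 - δ` by aggregating independent outputs with `f`. -/
def amplify (f : ∀ {k}, (Fin k → R) → S) (P : SampleProg ι X R) (δ : ℝ) : SampleProg ι X S :=
  (P.repeated (repetitions δ)).bind fun v => ret (f v)

theorem one_sub_le_prob_amplify {f : ∀ {k}, (Fin k → R) → S} {P : SampleProg ι X R}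
    {p : ι → PMF X} {A : Set R} {B : Set S} (hP : prob (P.run p) A ≤ 1 / 16)
    (hf : ∀ {k} {v : Fin k → R}, 2 * (v ⁻¹' A).ncard < k → f v ∈ B) {δ : ℝ}
    (hδ : 0 < δ) : 1 - δ ≤ prob ((amplify f P δ).run p) B := by
  have h_fail : prob ((amplify f P δ).run p) Bᶜ ≤ δ := by
    rw [amplify, run_bind_ret, prob_map, run_repeated]
    refine (prob_mono _ fun v hv => ?_).trans
      ((prob_iid_half_le_card_le (P.run p) hP _).trans (half_pow_repetitions_le hδ))
    rw [Set.mem_ofPred_eq, ← not_lt]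
    exact fun h => hv (hf h)
  linarith [prob_add_prob_compl ((amplify f P δ).run p) B]

theorem UsesAtMost.amplify {P : SampleProg ι X R} {a : ℝ} (hP : P.UsesAtMost a)
    (f : ∀ {k}, (Fin k → R) → S) {δ : ℝ} (hδ : 0 < δ) (hδ' : δ ≤ 1 / 2) :
    (amplify f P δ).UsesAtMost (3 * a * Real.log (1 / δ)) := by
  refine ((hP.repeated _).bind_ret f).mono ?_
  calc repetitions δ * a ≤ 3 * Real.log (1 / δ) * a :=
        mul_le_mul_of_nonneg_right (repetitions_le hδ hδ') hP.nonneg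
    _ = 3 * a * Real.log (1 / δ) := by ring

/-- A bilinear statistic of two independent groups of `k` outputs of `P`. -/
def bilinearStat (P : SampleProg ι X R) (h : R → R → ℝ) (k : ℕ) : SampleProg ι X ℝ :=
  (P.repeated k).bind fun v => (P.repeated k).bind fun w => ret (∑ j, ∑ i, h (v i) (w j))

theorem UsesAtMost.bilinearStat {P : SampleProg ι X R} {a : ℝ} (hP : P.UsesAtMost a)
    (h : R → R → ℝ) (k : ℕ) : (P.bilinearStat h k).UsesAtMost (2 * k * a) :=
  ((hP.repeated k).bind (hP.repeated k).nonneg fun v => (hP.repeated k).bind_ret _).mono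
    (le_of_eq (by ring))

theorem prob_bilinearStat_le [Fintype R] {p : ι → PMF X} {P : SampleProg ι X R} {μ : PMF R}
    (hP : P.run p = μ) {h : R → R → ℝ} (h_symm : ∀ a b, h a b = h b a) (k : ℕ) {s : ℝ}
    (hs : 0 < s) :
    prob ((P.bilinearStat h k).run p) {z | s ≤ |z - k ^ 2 * mean μ fun a => mean μ (h a)|}
      ≤ (k ^ 2 * (mean μ fun a => mean μ fun b => h a b ^ 2)
        + 2 * k ^ 3 * (mean μ fun a => mean μ (h a) ^ 2)) / s ^ 2 := by
  have h_var := mean_iid_bilinear_sub_sq_le μ h_symm k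
  set D := mean μ fun a => mean μ (h a)
  refine prob_le_div_of_expect_le _ (f := fun z => ENNReal.ofReal ((z - k ^ 2 * D) ^ 2))
    (by positivity) ((mean_nonneg _ fun v => mean_nonneg _ fun w => sq_nonneg _).trans h_var)
    (fun z hz => ENNReal.ofReal_le_ofReal ?_)
    ((ENNReal.ofReal_le_ofReal h_var).trans' (le_of_eq ?_))
  · rw [← sq_abs (z - _)]
    exact pow_le_pow_left₀ hs.le hz 2
  · rw [bilinearStat, run_bind, run_repeated, hP, expect_bind]
    simp only [run_bind_ret, run_repeated, hP, expect_map, Function.comp_def]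
    rw [← expect_ofReal _ fun v => mean_nonneg _ fun _ => sq_nonneg _]
    simp only [← expect_ofReal _ fun _ => sq_nonneg _]

end SampleProg

open SampleProg

section L2Norm

variable {X : Type} [Fintype X]

theorem l2NormSq_nonneg (p : PMF X) : 0 ≤ l2NormSq p := Finset.sum_nonneg fun _ _ => sq_nonneg _

theorem one_le_card_mul_l2NormSq (p : PMF X) : 1 ≤ Fintype.card X * l2NormSq p := by
  simpa only [sum_toReal_eq_one, one_pow, Finset.card_univ, l2NormSq] using
    sq_sum_le_card_mul_sum_sq (s := Finset.univ) (f := fun x => (p x).toReal)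

theorem l2NormSq_pos (p : PMF X) : 0 < l2NormSq p :=
  pos_of_mul_pos_right (zero_lt_one.trans_le (one_le_card_mul_l2NormSq p)) (Nat.cast_nonneg _)

theorem toReal_apply_le_sqrt_l2NormSq (p : PMF X) (x : X) : (p x).toReal ≤ √(l2NormSq p) :=
  Real.le_sqrt_of_sq_le (Finset.single_le_sum (f := fun x => (p x).toReal ^ 2)
    (fun _ _ => sq_nonneg _) (Finset.mem_univ x))

theorem mean_toReal_apply (p : PMF X) : (mean p fun x => (p x).toReal) = l2NormSq p :=
  Finset.sum_congr rfl fun _ _ => (sq _).symm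

theorem mean_toReal_apply_sq_le (p : PMF X) :
    (mean p fun x => (p x).toReal ^ 2) ≤ √(l2NormSq p) * l2NormSq p := by
  calc (mean p fun x => (p x).toReal ^ 2) ≤ mean p fun x => √(l2NormSq p) * (p x).toReal :=
        mean_mono p fun x => by
          rw [sq]
          exact mul_le_mul_of_nonneg_right (toReal_apply_le_sqrt_l2NormSq p x)
            ENNReal.toReal_nonneg
    _ = √(l2NormSq p) * l2NormSq p := by rw [mean_const_mul, mean_toReal_apply]

end L2Norm

section CollisionKernel

variable {X : Type} [DecidableEq X]

/-- The indicator of a collision. -/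
def collisionKernel (a b : X) : ℝ := if a = b then 1 else 0

theorem collisionKernel_comm (a b : X) : collisionKernel a b = collisionKernel b a := by
  simp only [collisionKernel, eq_comm]

theorem collisionKernel_sq (a b : X) : collisionKernel a b ^ 2 = collisionKernel a b := by
  simp only [collisionKernel, ite_pow, one_pow, ne_eq, OfNat.ofNat_ne_zero, not_false_eq_true,
    zero_pow]

theorem mean_collisionKernel [Fintype X] (p : PMF X) (a : X) :
    mean p (collisionKernel a) = (p a).toReal := by
  simp only [mean, collisionKernel, mul_ite, mul_one, mul_zero, Finset.sum_ite_eq, Finset.mem_univ,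
    if_true]

end CollisionKernel

/-- The size of each of the two groups of samples of the collision estimator. -/
def collisionSize (N : ℕ) : ℕ := ⌈256 * √(N : ℝ)⌉₊

theorem collisionSize_le (N : ℕ) : (collisionSize N : ℝ) ≤ 257 * √(N : ℝ) := by
  rcases N.eq_zero_or_pos with rfl | hN
  · simp [collisionSize]
  · have h_one : 1 ≤ √(N : ℝ) := Real.one_le_sqrt.2 (by exact_mod_cast hN)
    have h_ceil : (collisionSize N : ℝ) < 256 * √(N : ℝ) + 1 :=
      Nat.ceil_lt_add_one (by positivity)
    linarith

theorem le_collisionSize_mul_sqrt_l2NormSq {N : ℕ} (p : PMF (Fin N)) :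
    256 ≤ collisionSize N * √(l2NormSq p) := by
  have h_one : 1 ≤ √(N : ℝ) * √(l2NormSq p) := by
    rw [← Real.sqrt_mul N.cast_nonneg, Real.one_le_sqrt]
    simpa only [Fintype.card_fin] using one_le_card_mul_l2NormSq p
  calc 256 ≤ 256 * (√(N : ℝ) * √(l2NormSq p)) := by linarith
    _ = 256 * √(N : ℝ) * √(l2NormSq p) := by ring
    _ ≤ collisionSize N * √(l2NormSq p) := by
        gcongr
        exact Nat.le_ceil _

/-- Estimate the squared `ℓ₂`-norm by the rate of collisions between two groups of samples. -/
def collisionEstimator (N : ℕ) : SampleProg Unit (Fin N) ℝ :=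
  ((sample ()).bilinearStat collisionKernel (collisionSize N)).bind
    fun z => ret (z / (collisionSize N : ℝ) ^ 2)

theorem collision_variance_le {y : ℝ} (hy : 256 ≤ y) :
    (y ^ 2 + 2 * y ^ 3) / (y ^ 2 / 2) ^ 2 ≤ 1 / 16 := by
  rw [div_le_iff₀ (by positivity)]
  nlinarith [mul_nonneg (sub_nonneg.2 hy) (pow_nonneg (by linarith : 0 ≤ y) 3),
    mul_nonneg (sub_nonneg.2 hy) (pow_nonneg (by linarith : 0 ≤ y) 2)]

theorem prob_collisionEstimator_le {N : ℕ} (p : PMF (Fin N)) :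
    prob ((collisionEstimator N).run fun _ => p) (Set.Icc (l2NormSq p / 2) (3 * l2NormSq p / 2))ᶜ
      ≤ 1 / 16 := by
  set D := l2NormSq p with hD
  set k := collisionSize N
  have hy : 256 ≤ k * √D := le_collisionSize_mul_sqrt_l2NormSq p
  have hD_pos : 0 < D := l2NormSq_pos p
  have hk_pos : (0 : ℝ) < k := pos_of_mul_pos_left (by linarith) (Real.sqrt_nonneg D)
  have h_sqrt : √D ^ 2 = D := Real.sq_sqrt hD_pos.le
  have h_cheb := prob_bilinearStat_le (run_sample (fun _ => p) ())
    collisionKernel_comm k (s := k ^ 2 * D / 2) (by positivity)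
  simp only [collisionKernel_sq, mean_collisionKernel, mean_toReal_apply, ← hD] at h_cheb
  rw [collisionEstimator, run_bind_ret, prob_map]
  refine ((prob_mono _ fun z hz => ?_).trans h_cheb).trans ?_
  · rw [Set.mem_ofPred_eq]
    contrapose! hz
    rw [abs_lt] at hz
    rw [Set.mem_preimage, Set.notMem_compl_iff, Set.mem_Icc, le_div_iff₀ (by positivity),
      div_le_iff₀ (by positivity)]
    constructor <;> linarith
  · calc _ ≤ (k ^ 2 * D + 2 * k ^ 3 * (√D * D)) / (k ^ 2 * D / 2) ^ 2 := by
          gcongr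
          exact mean_toReal_apply_sq_le p
      _ = ((k * √D) ^ 2 + 2 * (k * √D) ^ 3) / ((k * √D) ^ 2 / 2) ^ 2 := by
          rw [mul_pow, mul_pow, pow_succ √D 2, h_sqrt, mul_comm D]
          ring
      _ ≤ 1 / 16 := collision_variance_le hy

/-- The largest real number that more than half of the entries reach. -/
def upperMedian {k : ℕ} (v : Fin k → ℝ) : ℝ := sSup {t | k < 2 * (v ⁻¹' Set.Ici t).ncard}

theorem upperMedian_mem_Icc {k : ℕ} {v : Fin k → ℝ} {a b : ℝ}
    (h : 2 * (v ⁻¹' (Set.Icc a b)ᶜ).ncard < k) : upperMedian v ∈ Set.Icc a b := by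
  have h_card := Set.ncard_add_ncard_compl (v ⁻¹' Set.Icc a b)
  rw [Nat.card_fin, ← Set.preimage_compl] at h_card
  have ha : a ∈ {t | k < 2 * (v ⁻¹' Set.Ici t).ncard} := by
    have h_le : (v ⁻¹' Set.Icc a b).ncard ≤ (v ⁻¹' Set.Ici a).ncard :=
      Set.ncard_le_ncard (Set.preimage_mono fun _ ht => ht.1)
    rw [Set.mem_ofPred_eq]
    omega
  have hb : ∀ t ∈ {t | k < 2 * (v ⁻¹' Set.Ici t).ncard}, t ≤ b := fun t ht => by
    by_contra! hbt
    have h_le : (v ⁻¹' Set.Ici t).ncard ≤ (v ⁻¹' (Set.Icc a b)ᶜ).ncard :=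
      Set.ncard_le_ncard (Set.preimage_mono fun _ hs hs' => (hbt.trans_le hs).not_ge hs'.2)
    rw [Set.mem_ofPred_eq] at ht
    omega
  exact ⟨le_csSup ⟨b, hb⟩ ha, csSup_le ⟨a, ha⟩ hb⟩

/-- The norm estimator: a median of independent collision estimates. -/
def normEstimator (N : ℕ) (δ : ℝ) : SampleProg Unit (Fin N) ℝ :=
  amplify upperMedian (collisionEstimator N) δ

theorem isL2NormEstimator_normEstimator : IsL2NormEstimator normEstimator := by
  refine ⟨1542, by norm_num, fun N δ hδ hδ' => ⟨?_, fun p => ?_⟩⟩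
  · have h_estimator : (collisionEstimator N).UsesAtMost (514 * √(N : ℝ)) :=
      (((UsesAtMost.sample ()).bilinearStat _ _).bind_ret _).mono
        (by linarith [collisionSize_le N])
    exact (h_estimator.amplify upperMedian hδ hδ').mono (le_of_eq (by ring))
  · exact one_sub_le_prob_amplify (B := Set.Icc (l2NormSq p / 2) (3 * l2NormSq p / 2))
      (prob_collisionEstimator_le p) upperMedian_mem_Icc hδ

section Product

variable {X Y : Type*}

/-- The product of two distributions. -/
def prodPMF (p : PMF X) (q : PMF Y) : PMF (X × Y) := p.bind fun x => q.map (Prod.mk x)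

theorem prodPMF_apply (p : PMF X) (q : PMF Y) (x : X) (y : Y) :
    prodPMF p q (x, y) = p x * q y := by
  rw [prodPMF, PMF.bind_apply, tsum_eq_single x, PMF.map_apply, tsum_eq_single y]
  · simp
  · intro y' hy'
    simp [hy'.symm]
  · intro x' hx'
    simp [PMF.map_apply, hx'.symm]

theorem map_fst_prodPMF (p : PMF X) (q : PMF Y) : (prodPMF p q).map Prod.fst = p := by
  have h_fst : ∀ x : X, Prod.fst ∘ Prod.mk x = Function.const Y x := fun _ => rfl
  simp only [prodPMF, PMF.map_bind, PMF.map_comp, h_fst, PMF.map_const, PMF.bind_pure]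

theorem map_snd_prodPMF (p : PMF X) (q : PMF Y) : (prodPMF p q).map Prod.snd = q := by
  have h_snd : ∀ x : X, Prod.snd ∘ Prod.mk x = (id : Y → Y) := fun _ => rfl
  simp only [prodPMF, PMF.map_bind, PMF.map_comp, h_snd, PMF.map_id, PMF.bind_const]

theorem mean_prodPMF [Fintype X] [Fintype Y] (p : PMF X) (q : PMF Y) (f : X × Y → ℝ) :
    mean (prodPMF p q) f = mean p fun x => mean q fun y => f (x, y) := by
  simp only [prodPMF, mean_bind, mean_map]

end Product

section L2Dist

variable {X : Type} [Fintype X]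

/-- The squared `ℓ₂`-distance of two distributions on a finite set. -/
def l2DistSq (p q : PMF X) : ℝ := ∑ x, ((p x).toReal - (q x).toReal) ^ 2

theorem l2DistSq_nonneg (p q : PMF X) : 0 ≤ l2DistSq p q := Finset.sum_nonneg fun _ _ => sq_nonneg _

theorem l2DistSq_comm (p q : PMF X) : l2DistSq p q = l2DistSq q p :=
  Finset.sum_congr rfl fun _ _ => by ring

theorem l2DistSq_self (p : PMF X) : l2DistSq p p = 0 := by
  simp only [l2DistSq, sub_self, ne_eq, OfNat.ofNat_ne_zero, not_false_eq_true, zero_pow,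
    Finset.sum_const_zero]

theorem l2NormSq_le_add_l2DistSq (p q : PMF X) :
    l2NormSq p ≤ 2 * l2NormSq q + 2 * l2DistSq p q := by
  simp only [l2NormSq, l2DistSq, Finset.mul_sum, ← Finset.sum_add_distrib]
  exact Finset.sum_le_sum fun x _ => by
    nlinarith [sq_nonneg ((p x).toReal - 2 * (q x).toReal)]

theorem l2NormSq_le_of_min_le {p q : PMF X} {b : ℝ} (hb : min (l2NormSq p) (l2NormSq q) ≤ b) :
    l2NormSq p ≤ 2 * (b + l2DistSq p q) ∧ l2NormSq q ≤ 2 * (b + l2DistSq p q) := by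
  have hpq := l2NormSq_le_add_l2DistSq p q
  have hqp := l2NormSq_le_add_l2DistSq q p
  rw [l2DistSq_comm q p] at hqp
  have := l2DistSq_nonneg p q
  have := l2NormSq_nonneg p
  have := l2NormSq_nonneg q
  rcases min_le_iff.1 hb with h | h <;> constructor <;> linarith

theorem four_mul_sq_le_card_mul_l2DistSq {p q : PMF X} {ε : ℝ} (hε : 0 ≤ ε) (h : ε ≤ tvDist p q) :
    4 * ε ^ 2 ≤ Fintype.card X * l2DistSq p q := by
  have h_cauchy := sq_sum_le_card_mul_sum_sq (s := Finset.univ)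
    (f := fun x => |(p x).toReal - (q x).toReal|)
  simp only [sq_abs, Finset.card_univ] at h_cauchy
  rw [tvDist] at h
  calc 4 * ε ^ 2 = (2 * ε) ^ 2 := by ring
    _ ≤ (∑ x, |(p x).toReal - (q x).toReal|) ^ 2 := by gcongr; linarith
    _ ≤ Fintype.card X * l2DistSq p q := h_cauchy

end L2Dist

section ClosenessKernel

variable {X : Type} [DecidableEq X]

/-- The inner product of `e_x - e_y` and `e_x' - e_y'`, for `a = (x, y)` and `b = (x', y')`; its
mean over independent pairs of samples is the squared `ℓ₂`-distance. -/
def closenessKernel (a b : X × X) : ℝ :=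
  collisionKernel a.1 b.1 + collisionKernel a.2 b.2
    - collisionKernel a.1 b.2 - collisionKernel a.2 b.1

theorem closenessKernel_comm (a b : X × X) : closenessKernel a b = closenessKernel b a := by
  simp only [closenessKernel, collisionKernel_comm a.1, collisionKernel_comm a.2]
  ring

theorem closenessKernel_sq_le (a b : X × X) : closenessKernel a b ^ 2 ≤
    4 * (collisionKernel a.1 b.1 + collisionKernel a.2 b.2
      + collisionKernel a.1 b.2 + collisionKernel a.2 b.1) := by
  unfold closenessKernel collisionKernel
  split_ifs <;> norm_num

variable [Fintype X] (p q : PMF X)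

theorem mean_closenessKernel (a : X × X) : mean (prodPMF p q) (closenessKernel a)
    = ((p a.1).toReal - (q a.1).toReal) - ((p a.2).toReal - (q a.2).toReal) := by
  simp only [mean_prodPMF, closenessKernel, mean_sub, mean_add, mean_const, mean_collisionKernel]
  ring

theorem mean_mean_closenessKernel :
    (mean (prodPMF p q) fun a => mean (prodPMF p q) (closenessKernel a)) = l2DistSq p q := by
  simp only [mean_closenessKernel]
  simp only [mean_prodPMF, mean_sub, mean_const]
  simp only [mean, l2DistSq, ← Finset.sum_sub_distrib]
  exact Finset.sum_congr rfl fun x _ => by ring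

theorem mean_mean_closenessKernel_sq_le :
    (mean (prodPMF p q) fun a => mean (prodPMF p q) fun b => closenessKernel a b ^ 2)
      ≤ 8 * (l2NormSq p + l2NormSq q) := by
  refine (mean_mono _ fun a => mean_mono _ (closenessKernel_sq_le a)).trans ?_
  simp only [mean_prodPMF, mean_const_mul, mean_add, mean_const, mean_collisionKernel]
  simp only [mean, l2NormSq, ← Finset.sum_add_distrib, Finset.mul_sum]
  exact Finset.sum_le_sum fun x _ => by nlinarith [sq_nonneg ((p x).toReal - (q x).toReal)]

theorem mean_closenessKernel_sq_le (a : X × X) : mean (prodPMF p q) (closenessKernel a) ^ 2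
    ≤ 2 * (((p a.1).toReal - (q a.1).toReal) ^ 2 + ((p a.2).toReal - (q a.2).toReal) ^ 2) := by
  rw [mean_closenessKernel, sub_eq_add_neg]
  exact add_sq_le.trans_eq (by rw [neg_sq])

theorem mean_mean_sq_closenessKernel_le :
    (mean (prodPMF p q) fun a => mean (prodPMF p q) (closenessKernel a) ^ 2)
      ≤ 2 * (√(l2NormSq p) + √(l2NormSq q)) * l2DistSq p q := by
  refine (mean_mono _ (mean_closenessKernel_sq_le p q)).trans ?_
  simp only [mean_prodPMF, mean_const_mul, mean_add, mean_const, mul_assoc]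
  gcongr
  simp only [mean, l2DistSq, ← Finset.sum_add_distrib, Finset.mul_sum, ← add_mul]
  exact Finset.sum_le_sum fun x _ => mul_le_mul_of_nonneg_right
    (add_le_add (toReal_apply_le_sqrt_l2NormSq p x) (toReal_apply_le_sqrt_l2NormSq q x))
    (sq_nonneg _)

end ClosenessKernel

/-- One sample from each of the two distributions. -/
def samplePair {X : Type} : SampleProg Bool X (X × X) :=
  (sample false).bind fun x => (sample true).bind fun y => ret (x, y)

theorem run_samplePair {X : Type} (p q : PMF X) :
    samplePair.run (fun i => bif i then q else p) = prodPMF p q := by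
  rw [samplePair, run_bind, run_sample]
  simp only [run_bind_ret, run_sample, prodPMF, cond_true, cond_false]

theorem usesAtMost_samplePair {X : Type} :
    (samplePair : SampleProg Bool X (X × X)).UsesAtMost 2 :=
  ((UsesAtMost.sample false).bind zero_le_one fun x =>
    (UsesAtMost.sample true).bind_ret (Prod.mk x)).mono (by norm_num)

/-- The size of each of the two groups of sample pairs of the `ℓ₂`-distance estimator. -/
def closenessSize (N : ℕ) (b ε : ℝ) : ℕ := ⌈1024 * (N * √b / ε ^ 2)⌉₊

/-- Accept if and only if the estimate of the squared `ℓ₂`-distance is small. -/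
def l2ClosenessTester (N : ℕ) (b ε : ℝ) : SampleProg Bool (Fin N) Bool :=
  (samplePair.bilinearStat closenessKernel (closenessSize N b ε)).bind fun z =>
    ret (decide (z < (closenessSize N b ε : ℝ) ^ 2 * (2 * ε ^ 2 / N)))

theorem sqrt_le_of_le_two_mul_add {x b D : ℝ} (hb : 0 ≤ b) (hD : 0 ≤ D) (h : x ≤ 2 * (b + D)) :
    √x ≤ 3 / 2 * (√b + √D) := by
  refine Real.sqrt_le_iff.2 ⟨by positivity, h.trans ?_⟩
  have h_cross : 0 ≤ √b * √D := by positivity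
  nlinarith [Real.sq_sqrt hb, Real.sq_sqrt hD]

section L2Closeness

variable {N : ℕ} {p q : PMF (Fin N)} {b ε : ℝ}

theorem prob_closenessStat_le (hb : 0 ≤ b) (hpq : min (l2NormSq p) (l2NormSq q) ≤ b) (k : ℕ)
    {s : ℝ} (hs : 0 < s) :
    prob ((samplePair.bilinearStat closenessKernel k).run fun i => bif i then q else p)
        {z | s ≤ |z - k ^ 2 * l2DistSq p q|}
      ≤ (k ^ 2 * (32 * (b + l2DistSq p q))
        + 2 * k ^ 3 * (6 * ((√b + √(l2DistSq p q)) * l2DistSq p q))) / s ^ 2 := by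
  have hD := l2DistSq_nonneg p q
  obtain ⟨hp, hq⟩ := l2NormSq_le_of_min_le hpq
  have h_cheb := prob_bilinearStat_le (run_samplePair p q) closenessKernel_comm k hs
  rw [mean_mean_closenessKernel] at h_cheb
  refine h_cheb.trans ?_
  gcongr (_ * ?_ + _ * ?_) / _
  · linarith [mean_mean_closenessKernel_sq_le p q]
  · calc _ ≤ 2 * (√(l2NormSq p) + √(l2NormSq q)) * l2DistSq p q :=
          mean_mean_sq_closenessKernel_le p q
      _ ≤ 6 * (√b + √(l2DistSq p q)) * l2DistSq p q := by
          gcongr ?_ * _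
          linarith [sqrt_le_of_le_two_mul_add hb hD hp, sqrt_le_of_le_two_mul_add hb hD hq]
      _ = 6 * ((√b + √(l2DistSq p q)) * l2DistSq p q) := mul_assoc _ _ _

theorem one_le_mul_of_min_l2NormSq_le (hpq : min (l2NormSq p) (l2NormSq q) ≤ b) : 1 ≤ N * b := by
  refine le_trans ?_ (mul_le_mul_of_nonneg_left hpq N.cast_nonneg)
  have h_p := one_le_card_mul_l2NormSq p
  have h_q := one_le_card_mul_l2NormSq q
  rw [Fintype.card_fin] at h_p h_q
  rcases min_choice (l2NormSq p) (l2NormSq q) with h | h <;> rwa [h]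

theorem le_closenessSize_mul_sq_div (hN : 0 < (N : ℝ)) (hε : 0 < ε) :
    1024 * √b ≤ closenessSize N b ε * (ε ^ 2 / N) := by
  calc 1024 * √b = 1024 * (N * √b / ε ^ 2) * (ε ^ 2 / N) := by field_simp
    _ ≤ closenessSize N b ε * (ε ^ 2 / N) := by
        gcongr
        exact Nat.le_ceil _

theorem prob_l2ClosenessTester_self (hb : 0 < b) (hε : 0 < ε) (hp : l2NormSq p ≤ b) :
    prob ((l2ClosenessTester N b ε).run fun i => bif i then p else p) {true}ᶜ ≤ 1 / 16 := by
  have hpp : min (l2NormSq p) (l2NormSq p) ≤ b := by rwa [min_self]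
  have hN : (0 : ℝ) < N :=
    pos_of_mul_pos_left (by linarith [one_le_mul_of_min_l2NormSq_le hpp]) hb.le
  have h_size : 1024 * √b ≤ closenessSize N b ε * (ε ^ 2 / N) := le_closenessSize_mul_sq_div hN hε
  set k := closenessSize N b ε
  have hb' : b = √b ^ 2 := (Real.sq_sqrt hb.le).symm
  have hk : (0 : ℝ) < k := pos_of_mul_pos_left (h_size.trans_lt' (by positivity)) (by positivity)
  have h_cheb := prob_closenessStat_le hb.le hpp k (s := k ^ 2 * (2 * ε ^ 2 / N)) (by positivity)
  simp only [l2DistSq_self, mul_zero, add_zero, sub_zero] at h_cheb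
  rw [l2ClosenessTester, run_bind_ret, prob_map]
  refine ((prob_mono _ fun z hz => ?_).trans h_cheb).trans ?_
  · rw [Set.mem_preimage, Set.mem_compl_iff, Set.mem_singleton_iff, decide_eq_true_eq, not_lt] at hz
    exact hz.trans (le_abs_self z)
  · rw [div_le_iff₀ (by positivity)]
    calc k ^ 2 * (32 * b) ≤ k ^ 2 * (1 / 4 * (1024 * √b) ^ 2) := by
          rw [mul_pow, ← hb']
          gcongr ?_ * ?_
          linarith
      _ ≤ k ^ 2 * (1 / 4 * (k * (ε ^ 2 / N)) ^ 2) := by gcongr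
      _ = 1 / 16 * (k ^ 2 * (2 * ε ^ 2 / N)) ^ 2 := by ring

theorem le_closenessSize_mul_l2DistSq (hN : 0 < (N : ℝ)) (hε : 0 < ε) (hpq : ε ≤ tvDist p q) :
    4096 * √b ≤ closenessSize N b ε * l2DistSq p q := by
  have h_dist : 4 * (ε ^ 2 / N) ≤ l2DistSq p q := by
    rw [mul_div_assoc', div_le_iff₀' hN]
    simpa only [Fintype.card_fin] using four_mul_sq_le_card_mul_l2DistSq hε.le hpq
  calc 4096 * √b = 4 * (1024 * √b) := by ring
    _ ≤ 4 * (closenessSize N b ε * (ε ^ 2 / N)) := by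
        gcongr 4 * ?_
        exact le_closenessSize_mul_sq_div hN hε
    _ = closenessSize N b ε * (4 * (ε ^ 2 / N)) := by ring
    _ ≤ closenessSize N b ε * l2DistSq p q := by gcongr

theorem le_closenessSize_mul_sqrt_l2DistSq (hN : 1 ≤ N * b) (hε : 0 < ε)
    (hε' : ε ≤ 1) (hpq : ε ≤ tvDist p q) :
    2048 ≤ closenessSize N b ε * √(l2DistSq p q) := by
  have h_sqrt : 1 ≤ √(N : ℝ) * √b := by rwa [← Real.sqrt_mul N.cast_nonneg, Real.one_le_sqrt]
  have h_dist : 2 * ε ≤ √(N : ℝ) * √(l2DistSq p q) := by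
    rw [← Real.sqrt_mul N.cast_nonneg]
    refine Real.le_sqrt_of_sq_le ?_
    have h_four := four_mul_sq_le_card_mul_l2DistSq hε.le hpq
    rw [Fintype.card_fin] at h_four
    linarith
  calc 2048 ≤ 2048 * (√(N : ℝ) * √b) := by linarith
    _ = 1024 * (√(N : ℝ) * √b / ε) * (2 * ε) := by
        field_simp
        ring
    _ ≤ 1024 * (√(N : ℝ) * √b / ε) * (√(N : ℝ) * √(l2DistSq p q)) := by gcongr
    _ = 1024 * (N * √b / ε) * √(l2DistSq p q) := by
        nth_rewrite 3 [← Real.mul_self_sqrt N.cast_nonneg]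
        ring
    _ ≤ 1024 * (N * √b / ε ^ 2) * √(l2DistSq p q) := by
        gcongr
        exact pow_le_of_le_one hε.le hε' two_ne_zero
    _ ≤ closenessSize N b ε * √(l2DistSq p q) := by
        gcongr
        exact Nat.le_ceil _

theorem closeness_variance_le {u y : ℝ} (hu : 0 ≤ u) (huy : 4096 * u ≤ y ^ 2) (hy : 2048 ≤ y) :
    (32 * (u ^ 2 + y ^ 2) + 12 * ((u + y) * y ^ 2)) / (y ^ 2 / 2) ^ 2 ≤ 1 / 16 := by
  have hu_sq : (4096 * u) ^ 2 ≤ (y ^ 2) ^ 2 := by gcongr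
  have hu_mul : 4096 * u * y ^ 2 ≤ y ^ 2 * y ^ 2 := by gcongr
  have hy_three : 2048 * y ^ 3 ≤ y * y ^ 3 := by gcongr
  have hy_two : 2048 * y ^ 2 ≤ y * y ^ 2 := by gcongr
  rw [div_le_iff₀ (by positivity)]
  nlinarith [pow_nonneg (by linarith : 0 ≤ y) 4]

theorem prob_l2ClosenessTester_far (hb : 0 < b) (hε : 0 < ε) (hε' : ε ≤ 1)
    (hpb : min (l2NormSq p) (l2NormSq q) ≤ b) (hpq : ε ≤ tvDist p q) :
    prob ((l2ClosenessTester N b ε).run fun i => bif i then q else p) {false}ᶜ ≤ 1 / 16 := by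
  have hNb := one_le_mul_of_min_l2NormSq_le hpb
  have hN : (0 : ℝ) < N := pos_of_mul_pos_left (by linarith) hb.le
  have hu : 4096 * √b ≤ closenessSize N b ε * l2DistSq p q :=
    le_closenessSize_mul_l2DistSq hN hε hpq
  have hy : 2048 ≤ closenessSize N b ε * √(l2DistSq p q) :=
    le_closenessSize_mul_sqrt_l2DistSq hNb hε hε' hpq
  have h_gap := four_mul_sq_le_card_mul_l2DistSq hε.le hpq
  rw [Fintype.card_fin] at h_gap
  have hD : 0 < l2DistSq p q := pos_of_mul_pos_right (h_gap.trans_lt' (by positivity)) hN.le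
  have hk : (0 : ℝ) < closenessSize N b ε :=
    pos_of_mul_pos_left (by linarith) (Real.sqrt_nonneg (l2DistSq p q))
  have h_cheb := prob_closenessStat_le hb.le hpb (closenessSize N b ε)
    (s := closenessSize N b ε ^ 2 * l2DistSq p q / 2) (by positivity)
  rw [l2ClosenessTester, run_bind_ret, prob_map]
  set k := closenessSize N b ε
  set D := l2DistSq p q
  have h_sqrt_b : √b ^ 2 = b := Real.sq_sqrt hb.le
  have h_sqrt_D : √D ^ 2 = D := Real.sq_sqrt hD.le
  refine ((prob_mono _ fun z hz => ?_).trans h_cheb).trans ?_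
  · have h_threshold : (k : ℝ) ^ 2 * (2 * ε ^ 2 / N) ≤ k ^ 2 * (D / 2) := by
      gcongr ?_ * ?_
      rw [div_le_iff₀ hN]
      linarith
    rw [Set.mem_preimage, Set.mem_compl_iff, Set.mem_singleton_iff, decide_eq_false_iff_not,
      not_not] at hz
    rw [Set.mem_ofPred_eq, abs_sub_comm]
    exact le_abs.2 (Or.inl (by linarith))
  · have huy : 4096 * (k * √b) ≤ (k * √D) ^ 2 := by
      rw [mul_pow, h_sqrt_D]
      nlinarith
    refine le_trans (le_of_eq ?_) (closeness_variance_le (by positivity) huy hy)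
    simp only [mul_pow, h_sqrt_b, h_sqrt_D]
    ring

end L2Closeness

/-- The answer given by more than half of the votes, `false` in case of a tie. -/
def majority {k : ℕ} (v : Fin k → Bool) : Bool := decide (k < 2 * (v ⁻¹' {true}).ncard)

theorem majority_eq {k : ℕ} {v : Fin k → Bool} {c : Bool} (h : 2 * (v ⁻¹' {c}ᶜ).ncard < k) :
    majority v = c := by
  have h_card := Set.ncard_add_ncard_compl (v ⁻¹' {c})
  rw [Nat.card_fin, ← Set.preimage_compl] at h_card
  cases c
  · have h_compl : ({false}ᶜ : Set Bool) = {true} := by ext c; simp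
    rw [h_compl] at h
    exact decide_eq_false (by omega)
  · exact decide_eq_true (by omega)

/-- The closeness tester: a majority vote of independent `ℓ₂`-closeness tests. If `N * b < 1`, no
distribution on `[N]` satisfies the norm bound and no samples are drawn. -/
def closenessTester (N : ℕ) (b ε δ : ℝ) : SampleProg Bool (Fin N) Bool :=
  if 1 ≤ N * b then amplify majority (l2ClosenessTester N b ε) δ else ret true

theorem one_sub_le_closenessTester {N : ℕ} {b ε δ : ℝ} (hδ : 0 < δ) (hN : 1 ≤ N * b)
    {p : Bool → PMF (Fin N)} {c : Bool}
    (h : prob ((l2ClosenessTester N b ε).run p) {c}ᶜ ≤ 1 / 16) :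
    1 - δ ≤ (((closenessTester N b ε δ).run p) c).toReal := by
  rw [closenessTester, if_pos hN, ← prob_singleton]
  exact one_sub_le_prob_amplify h majority_eq hδ

theorem one_le_mul_sqrt_div {N : ℕ} {b ε : ℝ} (hN : 1 ≤ N * b) (hε : 0 < ε) (hε' : ε ≤ 1) :
    1 ≤ N * √b / ε ^ 2 := by
  have hN_one : (1 : ℝ) ≤ N := by
    have hN_ne : N ≠ 0 := by
      rintro rfl
      norm_num at hN
    exact_mod_cast Nat.one_le_iff_ne_zero.2 hN_ne
  rw [one_le_div (by positivity)]
  calc ε ^ 2 ≤ 1 := pow_le_one₀ hε.le hε'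
    _ ≤ √(N : ℝ) * √b := by rwa [← Real.sqrt_mul N.cast_nonneg, Real.one_le_sqrt]
    _ ≤ N * √b := by
        gcongr
        exact Real.sqrt_le_self_iff.2 (Or.inr hN_one)

theorem usesAtMost_l2ClosenessTester {N : ℕ} {b ε : ℝ} (hN : 1 ≤ N * b) (hε : 0 < ε)
    (hε' : ε ≤ 1) : (l2ClosenessTester N b ε).UsesAtMost (4100 * (N * √b / ε ^ 2)) := by
  have h_one := one_le_mul_sqrt_div hN hε hε'
  have h_ceil : (closenessSize N b ε : ℝ) < 1024 * (N * √b / ε ^ 2) + 1 :=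
    Nat.ceil_lt_add_one (by positivity)
  exact ((usesAtMost_samplePair.bilinearStat _ _).bind_ret _).mono (by linarith)

theorem isClosenessTester_closenessTester : IsClosenessTester closenessTester := by
  refine ⟨12300, by norm_num, fun N b ε δ hb hε hε' hδ hδ' => ⟨?_, fun p q hpq => ?_⟩⟩
  · by_cases hN : 1 ≤ N * b
    · rw [closenessTester, if_pos hN]
      exact ((usesAtMost_l2ClosenessTester hN hε hε'.le).amplify majority hδ hδ').mono
        (le_of_eq (by ring))
    · have : 0 ≤ Real.log (1 / δ) := Real.log_nonneg (by rw [le_div_iff₀ hδ]; linarith)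
      rw [closenessTester, if_neg hN]
      exact UsesAtMost.ret _ (by positivity)
  · have hN := one_le_mul_of_min_l2NormSq_le hpq
    refine ⟨?_, fun h_far => one_sub_le_closenessTester hδ hN
      (prob_l2ClosenessTester_far hb hε hε'.le hpq h_far)⟩
    rintro rfl
    exact one_sub_le_closenessTester hδ hN
      (prob_l2ClosenessTester_self hb hε (by rwa [min_self] at hpq))

theorem isProductDist_iff {n m : ℕ} (p : PMF (Fin n × Fin m)) :
    IsProductDist p ↔ prodPMF (p.map Prod.fst) (p.map Prod.snd) = p := by
  constructor
  · rintro ⟨q, r, h⟩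
    have h_prod : p = prodPMF q r := by
      ext ⟨i, j⟩
      rw [h, prodPMF_apply]
    rw [h_prod, map_fst_prodPMF, map_snd_prodPMF]
  · intro h
    exact ⟨p.map Prod.fst, p.map Prod.snd, fun i j => by rw [← prodPMF_apply, h]⟩

section Invariance

variable {X Y : Type} [Fintype X] [Fintype Y]

theorem l2NormSq_map_equiv (e : X ≃ Y) (p : PMF X) : l2NormSq (p.map e) = l2NormSq p := by
  unfold l2NormSq
  rw [← e.sum_comp]
  simp only [toReal_map_apply_of_injective e.injective]

theorem tvDist_map_equiv (e : X ≃ Y) (p q : PMF X) : tvDist (p.map e) (q.map e) = tvDist p q := by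
  unfold tvDist
  rw [← e.sum_comp]
  simp only [toReal_map_apply_of_injective e.injective]

theorem l2NormSq_prodPMF (p : PMF X) (q : PMF Y) :
    l2NormSq (prodPMF p q) = l2NormSq p * l2NormSq q := by
  simp only [l2NormSq, Fintype.sum_prod_type, prodPMF_apply, ENNReal.toReal_mul, mul_pow,
    Finset.sum_mul_sum]

end Invariance

section Flattening

variable {n m : ℕ} (b : Fin n → ℕ) [∀ i, NeZero (b i)]

/-- The uniform distribution on the buckets of `i`. -/
def bucketPMF (i : Fin n) : PMF (Fin (∑ i, b i)) :=
  (PMF.uniformOfFintype (Fin (b i))).map fun k => finSigmaFinEquiv ⟨i, k⟩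

theorem toReal_bucketPMF_apply (i i' : Fin n) (k : Fin (b i')) :
    (bucketPMF b i (finSigmaFinEquiv ⟨i', k⟩)).toReal = if i = i' then (b i' : ℝ)⁻¹ else 0 := by
  split_ifs with h
  · subst h
    have h_inj : Function.Injective fun k : Fin (b i) =>
        finSigmaFinEquiv (⟨i, k⟩ : Σ i, Fin (b i)) :=
      finSigmaFinEquiv.injective.comp sigma_mk_injective
    exact (toReal_map_apply_of_injective h_inj _ k).trans (by simp)
  · rw [← prob_singleton, bucketPMF, prob_map, Set.preimage_singleton_eq_empty.2, prob,
      MeasureTheory.measure_empty, ENNReal.toReal_zero]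
    rintro ⟨k', hk'⟩
    exact h (congrArg Sigma.fst (finSigmaFinEquiv.injective hk'))

/-- The flattening of a distribution on `[n]`: each `i` is replaced by a uniformly random one of its
`b i` buckets. -/
def flattening (p : PMF (Fin n)) : PMF (Fin (∑ i, b i)) := p.bind (bucketPMF b)

theorem toReal_flattening_apply (p : PMF (Fin n)) (i : Fin n) (k : Fin (b i)) :
    (flattening b p (finSigmaFinEquiv ⟨i, k⟩)).toReal = (p i).toReal / b i := by
  simp only [flattening, toReal_bind_apply, mean, toReal_bucketPMF_apply, mul_ite, mul_zero,
    Finset.sum_ite_eq', Finset.mem_univ, if_true, div_eq_mul_inv]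

theorem sum_eq_sum_sum_buckets {b : Fin n → ℕ} (f : Fin (∑ i, b i) → ℝ) :
    ∑ u, f u = ∑ i, ∑ k : Fin (b i), f (finSigmaFinEquiv ⟨i, k⟩) := by
  rw [← finSigmaFinEquiv.sum_comp, Fintype.sum_sigma]

theorem l2NormSq_flattening (p : PMF (Fin n)) :
    l2NormSq (flattening b p) = ∑ i, (p i).toReal ^ 2 / b i := by
  rw [l2NormSq, sum_eq_sum_sum_buckets]
  refine Finset.sum_congr rfl fun i _ => ?_
  have h_ne : (b i : ℝ) ≠ 0 := NeZero.ne _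
  simp only [toReal_flattening_apply, Finset.sum_const, Finset.card_univ, Fintype.card_fin,
    nsmul_eq_mul]
  field_simp

variable (b₁ : Fin n → ℕ) (b₂ : Fin m → ℕ) [∀ i, NeZero (b₁ i)] [∀ j, NeZero (b₂ j)]

/-- The flattening of a distribution on `[n] × [m]`, coordinate by coordinate. -/
def jointFlattening (p : PMF (Fin n × Fin m)) : PMF (Fin (∑ i, b₁ i) × Fin (∑ j, b₂ j)) :=
  p.bind fun x => prodPMF (bucketPMF b₁ x.1) (bucketPMF b₂ x.2)

theorem jointFlattening_prodPMF (p : PMF (Fin n)) (q : PMF (Fin m)) :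
    jointFlattening b₁ b₂ (prodPMF p q) = prodPMF (flattening b₁ p) (flattening b₂ q) := by
  simp only [jointFlattening, prodPMF, flattening, PMF.bind_bind, PMF.bind_map, PMF.map_bind,
    Function.comp_def]
  congr 1
  ext1 i
  rw [PMF.bind_comm]

theorem toReal_jointFlattening_apply (p : PMF (Fin n × Fin m)) (i : Fin n) (k : Fin (b₁ i))
    (j : Fin m) (l : Fin (b₂ j)) :
    (jointFlattening b₁ b₂ p (finSigmaFinEquiv ⟨i, k⟩, finSigmaFinEquiv ⟨j, l⟩)).toReal
      = (p (i, j)).toReal / (b₁ i * b₂ j) := by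
  simp only [jointFlattening, toReal_bind_apply, mean, prodPMF_apply, ENNReal.toReal_mul,
    toReal_bucketPMF_apply, Fintype.sum_prod_type, mul_ite, ite_mul, zero_mul, mul_zero,
    Finset.sum_ite_eq', Finset.mem_univ, if_true, div_eq_mul_inv, mul_inv]

theorem tvDist_jointFlattening (p q : PMF (Fin n × Fin m)) :
    tvDist (jointFlattening b₁ b₂ p) (jointFlattening b₁ b₂ q) = tvDist p q := by
  unfold tvDist
  rw [Fintype.sum_prod_type, Fintype.sum_prod_type, sum_eq_sum_sum_buckets]
  congr 1
  refine Finset.sum_congr rfl fun i _ => ?_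
  have hi : (b₁ i : ℝ) ≠ 0 := NeZero.ne _
  simp only [sum_eq_sum_sum_buckets (b := b₂), toReal_jointFlattening_apply, ← sub_div, abs_div,
    abs_mul, Nat.abs_cast, Finset.sum_const, Finset.card_univ, Fintype.card_fin, nsmul_eq_mul,
    Finset.mul_sum]
  refine Finset.sum_congr rfl fun j _ => ?_
  have hj : (b₂ j : ℝ) ≠ 0 := NeZero.ne _
  field_simp

section Run

variable (p : PMF (Fin n × Fin m))

theorem run_flattenPoint {ι X : Type} (q : ι → PMF X) (i : Fin n) :
    (flattenPoint b i).run q = bucketPMF b i := by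
  simp only [flattenPoint, monad_bind_eq_bind, pure_eq_ret, run_bind_ret, run_random, bucketPMF]

theorem run_flatSample₁ :
    (flatSample₁ b : SampleProg Unit (Fin n × Fin m) _).run (fun _ => p)
      = flattening b (p.map Prod.fst) := by
  simp only [flatSample₁, monad_bind_eq_bind, run_bind, run_sample, run_flattenPoint, flattening,
    PMF.bind_map, Function.comp_def]

theorem run_flatSample₂ :
    (flatSample₂ b₂ : SampleProg Unit (Fin n × Fin m) _).run (fun _ => p)
      = flattening b₂ (p.map Prod.snd) := by
  simp only [flatSample₂, monad_bind_eq_bind, run_bind, run_sample, run_flattenPoint, flattening,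
    PMF.bind_map, Function.comp_def]

theorem run_flatSampleJoint :
    (flatSampleJoint b₁ b₂).run (fun _ => p)
      = (jointFlattening b₁ b₂ p).map finProdFinEquiv := by
  simp only [flatSampleJoint, monad_bind_eq_bind, pure_eq_ret, run_bind, run_ret, run_sample,
    run_flattenPoint, jointFlattening, prodPMF, PMF.map_bind, PMF.map_comp]
  rfl

theorem run_flatSampleProd :
    (flatSampleProd b₁ b₂).run (fun _ => p)
      = (prodPMF (flattening b₁ (p.map Prod.fst)) (flattening b₂ (p.map Prod.snd))).map
          finProdFinEquiv := by
  simp only [flatSampleProd, monad_bind_eq_bind, pure_eq_ret, run_bind, run_ret, run_flatSample₁,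
    run_flatSample₂, prodPMF, PMF.map_bind, PMF.map_comp]
  rfl

end Run

theorem usesAtMost_flattenPoint {ι X : Type} (i : Fin n) :
    (flattenPoint b i : SampleProg ι X _).UsesAtMost 0 :=
  (UsesAtMost.random _).bind_ret _

theorem usesAtMost_flatSample₁ :
    (flatSample₁ b : SampleProg Unit (Fin n × Fin m) _).UsesAtMost 1 :=
  (UsesAtMost.sample ()).bind_of_forall_zero fun x => usesAtMost_flattenPoint b x.1

theorem usesAtMost_flatSample₂ :
    (flatSample₂ b₂ : SampleProg Unit (Fin n × Fin m) _).UsesAtMost 1 :=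
  (UsesAtMost.sample ()).bind_of_forall_zero fun x => usesAtMost_flattenPoint b₂ x.2

theorem usesAtMost_flatSampleJoint : (flatSampleJoint b₁ b₂).UsesAtMost 1 :=
  (UsesAtMost.sample ()).bind_of_forall_zero fun x =>
    (usesAtMost_flattenPoint b₁ x.1).bind_of_forall_zero fun _ =>
      (usesAtMost_flattenPoint b₂ x.2).bind_ret _

theorem usesAtMost_flatSampleProd : (flatSampleProd b₁ b₂).UsesAtMost 2 :=
  ((usesAtMost_flatSample₁ b₁).bind zero_le_one fun _ =>
    (usesAtMost_flatSample₂ b₂).bind_ret _).mono (by norm_num)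

end Flattening

section Poisson

variable {s : ℝ} (hs : 0 ≤ s)

include hs

theorem poisson_apply (t : ℕ) :
    poisson s t = ENNReal.ofReal (Real.exp (-s) * s ^ t / t.factorial) := by
  rw [poisson, MeasureTheory.Measure.toPMF_apply, ProbabilityTheory.poissonMeasure_singleton,
    Real.coe_toNNReal s hs]

theorem poisson_succ_mul (t : ℕ) :
    poisson s (t + 1) * (t + 1) = ENNReal.ofReal s * poisson s t := by
  have h_cast : (t + 1 : ℝ≥0∞) = ENNReal.ofReal (t + 1) := by
    rw [ENNReal.ofReal_add t.cast_nonneg zero_le_one, ENNReal.ofReal_natCast, ENNReal.ofReal_one]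
  rw [h_cast, poisson_apply hs, poisson_apply hs, ← ENNReal.ofReal_mul (by positivity),
    ← ENNReal.ofReal_mul hs, Nat.factorial_succ]
  congr 1
  push_cast
  field_simp
  ring

theorem expect_poisson_natCast : expect (poisson s) (fun t => t) = ENNReal.ofReal s := by
  unfold expect
  rw [tsum_eq_zero_add' ENNReal.summable]
  simp only [Nat.cast_zero, mul_zero, Nat.cast_add, Nat.cast_one, zero_add, poisson_succ_mul hs,
    ENNReal.tsum_mul_left, PMF.tsum_coe, mul_one]

theorem ofReal_mul_expect_poisson_inv_le :
    ENNReal.ofReal s * expect (poisson s) (fun t => (t + 1 : ℝ≥0∞)⁻¹) ≤ 1 := by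
  rw [← expect_const_mul]
  calc (expect (poisson s) fun t => ENNReal.ofReal s * (t + 1 : ℝ≥0∞)⁻¹)
      = ∑' t, poisson s (t + 1) := by
        refine tsum_congr fun t => ?_
        have h_cancel : (t + 1 : ℝ≥0∞) * (t + 1 : ℝ≥0∞)⁻¹ = 1 :=
          ENNReal.mul_inv_cancel (by simp) (by finiteness)
        rw [mul_left_comm, ← mul_assoc, ← poisson_succ_mul hs, mul_assoc, h_cancel, mul_one]
    _ ≤ ∑' t, poisson s t := ENNReal.tsum_comp_le_tsum_of_injective (add_left_injective 1) _
    _ = 1 := (poisson s).tsum_coe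

theorem prob_poisson_gt_le : prob (poisson s) {t | (t : ℝ) > 160 * s} ≤ 1 / 160 := by
  have h_mean := (expect_poisson_natCast hs).le
  rcases hs.eq_or_lt with rfl | hs_pos
  · refine (prob_le_div_of_expect_le _ one_pos le_rfl (fun t ht => ?_) h_mean).trans (by norm_num)
    rw [Set.mem_ofPred_eq, mul_zero, gt_iff_lt, Nat.cast_pos] at ht
    rw [ENNReal.ofReal_one]
    exact_mod_cast ht
  · refine (prob_le_div_of_expect_le (c := 160 * s) _ (by positivity) hs (fun t ht => ?_)
      h_mean).trans (le_of_eq (by field_simp))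
    rw [← ENNReal.ofReal_natCast]
    exact ENNReal.ofReal_le_ofReal (le_of_lt ht)

end Poisson

section Frequencies

theorem iid_map {Ω Ω₂ : Type*} (μ : PMF Ω) (g : Ω → Ω₂) (k : ℕ) :
    iid (μ.map g) k = (iid μ k).map (g ∘ ·) := by
  induction k with
  | zero =>
    rw [iid, iid, PMF.pure_map]
    exact congrArg PMF.pure (Subsingleton.elim _ _)
  | succ k ih =>
    have comp_cons : ∀ x, (g ∘ ·) ∘ Fin.cons (α := fun _ : Fin (k + 1) => Ω) x
        = Fin.cons (g x) ∘ (g ∘ ·) := fun x => funext fun v => by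
      ext j
      refine Fin.cases ?_ (fun j => ?_) j <;> rfl
    simp only [iid, PMF.bind_map, PMF.map_bind, PMF.map_comp, comp_cons, ih]
    rfl

variable {Ω : Type*} [DecidableEq Ω] (μ : PMF Ω) (a : Ω)

theorem expect_count_succ (t : ℕ) (f : ℕ → ℝ≥0∞) :
    (expect (iid μ (t + 1)) fun v => f ((List.ofFn v).count a))
      = μ a * (expect (iid μ t) fun v => f ((List.ofFn v).count a + 1))
        + ENNReal.ofReal (prob μ {a}ᶜ) * expect (iid μ t) fun v => f ((List.ofFn v).count a) := by
  have h_apply : μ a = expect μ (Set.indicator {a} 1) := by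
    rw [← ofReal_prob, prob_singleton, ENNReal.ofReal_toReal (μ.apply_ne_top a)]
  rw [expect_iid_succ, h_apply, ofReal_prob, ← expect_mul_const, ← expect_mul_const, ← expect_add]
  congr 1
  ext x
  by_cases hx : x = a <;> simp [hx]

/-- The size-bias identity of the binomial distribution. -/
theorem expect_count_mul (t : ℕ) (f : ℕ → ℝ≥0∞) :
    (expect (iid μ (t + 1)) fun v =>
        (List.ofFn v).count a * f ((List.ofFn v).count a - 1))
      = (t + 1) * μ a * expect (iid μ t) fun v => f ((List.ofFn v).count a) := by
  induction t generalizing f with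
  | zero =>
    rw [expect_count_succ μ a 0 fun k => k * f (k - 1)]
    simp [iid, expect_pure]
  | succ t ih =>
    have h_split : ∀ k : ℕ, ((k + 1 : ℕ) : ℝ≥0∞) * f (k + 1 - 1)
        = k * (fun k => f (k + 1)) (k - 1) + f k := fun k => by
      cases k <;> simp [add_mul]
    rw [expect_count_succ μ a (t + 1) fun k => k * f (k - 1)]
    simp only [h_split, expect_add]
    rw [ih fun k => f (k + 1), ih f, expect_count_succ μ a t f]
    push_cast
    ring

theorem mul_expect_inv_count_le (t : ℕ) :
    (t + 1) * μ a * (expect (iid μ t) fun v => ((List.ofFn v).count a + 1 : ℝ≥0∞)⁻¹) ≤ 1 := by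
  rw [← expect_count_mul μ a t fun k => (k + 1 : ℝ≥0∞)⁻¹]
  refine expect_le_of_le _ fun v => ?_
  rcases Nat.eq_zero_or_eq_succ_pred ((List.ofFn v).count a) with h | h
  · rw [h, Nat.cast_zero, zero_mul]
    exact zero_le
  · rw [h, Nat.succ_sub_one, Nat.cast_succ]
    exact ENNReal.mul_inv_le_one _

end Frequencies

section PoissonSamples

variable {Ω : Type*}

/-- The law of a list of independent samples from `μ` whose length is Poisson with mean `s`. -/
def poissonSamples (μ : PMF Ω) (s : ℝ) : PMF (List Ω) :=
  (poisson s).bind fun t => (iid μ t).map List.ofFn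

theorem expect_poissonSamples (μ : PMF Ω) (s : ℝ) (f : List Ω → ℝ≥0∞) :
    expect (poissonSamples μ s) f
      = expect (poisson s) fun t => expect (iid μ t) fun v => f (List.ofFn v) := by
  simp only [poissonSamples, expect_bind, expect_map, Function.comp_def]

theorem poissonSamples_map {Ω₂ : Type*} (μ : PMF Ω) (g : Ω → Ω₂) (s : ℝ) :
    (poissonSamples μ s).map (List.map g) = poissonSamples (μ.map g) s := by
  simp only [poissonSamples, PMF.map_bind, PMF.map_comp, iid_map, Function.comp_def, List.map_ofFn]

theorem mul_expect_poissonSamples_inv_count_le [DecidableEq Ω] (μ : PMF Ω) (a : Ω) {s : ℝ}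
    (hs : 0 ≤ s) :
    ENNReal.ofReal s * μ a * (expect (poissonSamples μ s) fun l => (l.count a + 1 : ℝ≥0∞)⁻¹)
      ≤ 1 := by
  refine le_trans ?_ (ofReal_mul_expect_poisson_inv_le hs)
  rw [mul_assoc, expect_poissonSamples, ← expect_const_mul]
  gcongr
  refine expect_mono _ fun t => ?_
  rw [ENNReal.le_inv_iff_mul_le]
  refine le_trans (le_of_eq ?_) (mul_expect_inv_count_le μ a t)
  ring

end PoissonSamples

section TvDist

variable {X : Type} [Fintype X] (p q : PMF X)

theorem tvDist_map_le {Y : Type} [Fintype Y] (f : X → Y) :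
    tvDist (p.map f) (q.map f) ≤ tvDist p q := by
  classical
  have h_map (r : PMF X) (y : Y) :
      (r.map f y).toReal = ∑ x, if y = f x then (r x).toReal else 0 := by
    simp only [PMF.map, toReal_bind_apply, mean, Function.comp_apply, PMF.pure_apply,
      apply_ite ENNReal.toReal, ENNReal.toReal_one, ENNReal.toReal_zero, mul_ite, mul_one, mul_zero]
  unfold tvDist
  gcongr
  calc ∑ y, |(p.map f y).toReal - (q.map f y).toReal|
      ≤ ∑ y, ∑ x, if y = f x then |(p x).toReal - (q x).toReal| else 0 := by
        refine Finset.sum_le_sum fun y _ => ?_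
        rw [h_map, h_map, ← Finset.sum_sub_distrib]
        refine (Finset.abs_sum_le_sum_abs _ _).trans (Finset.sum_le_sum fun x _ => ?_)
        split_ifs <;> simp
    _ = ∑ x, |(p x).toReal - (q x).toReal| := by
        rw [Finset.sum_comm]
        simp only [Finset.sum_ite_eq', Finset.mem_univ, if_true]

theorem sum_max_sub_eq_tvDist : ∑ x, max ((p x).toReal - (q x).toReal) 0 = tvDist p q := by
  have h_max : ∀ x, max ((p x).toReal - (q x).toReal) 0
      = 1 / 2 * |(p x).toReal - (q x).toReal| + 1 / 2 * ((p x).toReal - (q x).toReal) := fun x => by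
    rcases le_total 0 ((p x).toReal - (q x).toReal) with h | h
    · rw [max_eq_left h, abs_of_nonneg h]
      ring
    · rw [max_eq_right h, abs_of_nonpos h]
      ring
  simp only [h_max, Finset.sum_add_distrib, ← Finset.mul_sum, Finset.sum_sub_distrib,
    sum_toReal_eq_one, sub_self, mul_zero, add_zero, tvDist]

variable {p q}

theorem eq_of_tvDist_le_zero (h : tvDist p q ≤ 0) : p = q := by
  have h_sum : ∑ x, |(p x).toReal - (q x).toReal| = 0 := by
    refine le_antisymm ?_ (Finset.sum_nonneg fun x _ => abs_nonneg _)
    rw [tvDist] at h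
    linarith
  ext x
  have h_abs := (Finset.sum_eq_zero_iff_of_nonneg fun x _ => abs_nonneg _).1 h_sum x
    (Finset.mem_univ x)
  exact (ENNReal.toReal_eq_toReal_iff' (p.apply_ne_top x) (q.apply_ne_top x)).1
    (sub_eq_zero.1 (abs_eq_zero.1 h_abs))

end TvDist

section ExpectedNorm

variable {n : ℕ} (p q : PMF (Fin n))

theorem cast_buckets (l : List (Fin n)) (i : Fin n) :
    (buckets q l i : ℝ) = ⌊n * (q i).toReal⌋₊ + l.count i + 1 := by
  simp only [buckets, Nat.cast_add, Nat.cast_one]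

variable {p q} in
theorem sq_div_buckets_le {i : Fin n} (h : (p i).toReal ≤ 2 * (q i).toReal) (l : List (Fin n)) :
    (p i).toReal ^ 2 / buckets q l i ≤ 2 / n * (p i).toReal := by
  have hn : (0 : ℝ) < n := Nat.cast_pos.2 i.pos
  have : 0 ≤ (p i).toReal := ENNReal.toReal_nonneg
  have h_prediction : n * (q i).toReal ≤ buckets q l i := by
    rw [cast_buckets]
    linarith [Nat.lt_floor_add_one (n * (q i).toReal), (l.count i).cast_nonneg (α := ℝ)]
  have hb : (0 : ℝ) < buckets q l i := Nat.cast_pos.2 (Nat.succ_pos _)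
  rw [div_mul_eq_mul_div, div_le_div_iff₀ hb hn]
  calc (p i).toReal ^ 2 * n = (p i).toReal * (n * (p i).toReal) := by ring
    _ ≤ (p i).toReal * (n * (2 * (q i).toReal)) := by gcongr
    _ = 2 * (p i).toReal * (n * (q i).toReal) := by ring
    _ ≤ 2 * (p i).toReal * buckets q l i := by gcongr

theorem expect_sq_div_buckets_le_div {s : ℝ} (hs : 0 < s) (i : Fin n) :
    (expect (poissonSamples p s) fun l => ENNReal.ofReal ((p i).toReal ^ 2 / buckets q l i))
      ≤ ENNReal.ofReal ((p i).toReal / s) := by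
  have hp : 0 ≤ (p i).toReal := ENNReal.toReal_nonneg
  have h_count : ∀ l : List (Fin n), ENNReal.ofReal ((p i).toReal ^ 2 / buckets q l i)
      ≤ ENNReal.ofReal ((p i).toReal / s) * (ENNReal.ofReal s * p i)
        * (l.count i + 1 : ℝ≥0∞)⁻¹ := fun l => by
    have h_inv : (l.count i + 1 : ℝ≥0∞)⁻¹ = ENNReal.ofReal ((l.count i + 1 : ℝ)⁻¹) := by
      rw [ENNReal.ofReal_inv_of_pos (by positivity), ENNReal.ofReal_add (by positivity) zero_le_one,
        ENNReal.ofReal_natCast, ENNReal.ofReal_one]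
    rw [h_inv, ← ENNReal.ofReal_toReal (p.apply_ne_top i), ← ENNReal.ofReal_mul hs.le,
      ← ENNReal.ofReal_mul (by positivity), ← ENNReal.ofReal_mul (by positivity),
      ENNReal.toReal_ofReal hp]
    refine ENNReal.ofReal_le_ofReal ?_
    have h_sq : (p i).toReal / s * (s * (p i).toReal) = (p i).toReal ^ 2 := by field_simp
    rw [h_sq, ← div_eq_mul_inv, cast_buckets]
    gcongr
    exact le_add_of_nonneg_left (Nat.cast_nonneg _)
  refine (expect_mono _ h_count).trans ?_
  rw [expect_const_mul, mul_assoc]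
  exact mul_le_of_le_one_right' (mul_expect_poissonSamples_inv_count_le p i hs.le)

variable {p q}

theorem expect_sq_div_buckets_le {s : ℝ} (hs : 0 ≤ s) (hs' : s = 0 → p = q) (i : Fin n) :
    (expect (poissonSamples p s) fun l => ENNReal.ofReal ((p i).toReal ^ 2 / buckets q l i))
      ≤ ENNReal.ofReal (2 / n * (p i).toReal + 2 / s * max ((p i).toReal - (q i).toReal) 0) := by
  have : 0 ≤ (p i).toReal := ENNReal.toReal_nonneg
  have hq : 0 ≤ (q i).toReal := ENNReal.toReal_nonneg
  rcases le_or_gt (p i).toReal (2 * (q i).toReal) with hpq | hpq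
  · exact expect_le_of_le _ fun l => ENNReal.ofReal_le_ofReal
      ((sq_div_buckets_le hpq l).trans (le_add_of_nonneg_right (by positivity)))
  · have hs_pos : 0 < s := by
      refine hs.lt_of_ne fun h => hpq.not_ge ?_
      rw [hs' h.symm]
      linarith
    refine (expect_sq_div_buckets_le_div p q hs_pos i).trans (ENNReal.ofReal_le_ofReal ?_)
    refine le_add_of_nonneg_of_le (by positivity) ?_
    rw [div_mul_eq_mul_div]
    gcongr
    linarith [le_max_left ((p i).toReal - (q i).toReal) 0]

theorem expect_l2NormSq_flattening_le {s α : ℝ} (hs : 0 ≤ s) (hs' : s = 0 → α = 0)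
    (hα : tvDist p q ≤ α) :
    (expect (poissonSamples p s) fun l =>
        ENNReal.ofReal (l2NormSq (flattening (buckets q l) p)))
      ≤ ENNReal.ofReal (2 * α / s + 4 / n) := by
  have h_eq : s = 0 → p = q := fun h => eq_of_tvDist_le_zero (hα.trans_eq (hs' h))
  have h_nonneg : ∀ i, 0 ≤ 2 / n * (p i).toReal + 2 / s * max ((p i).toReal - (q i).toReal) 0 :=
    fun i => by positivity
  have h_sum : ∀ l, ENNReal.ofReal (l2NormSq (flattening (buckets q l) p))
      = ∑ i, ENNReal.ofReal ((p i).toReal ^ 2 / buckets q l i) := fun l => by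
    rw [l2NormSq_flattening, ENNReal.ofReal_sum_of_nonneg fun i _ => by positivity]
  simp only [h_sum, expect_finset_sum]
  refine (Finset.sum_le_sum fun i _ => expect_sq_div_buckets_le hs h_eq i).trans ?_
  rw [← ENNReal.ofReal_sum_of_nonneg fun i _ => h_nonneg i]
  refine ENNReal.ofReal_le_ofReal ?_
  rw [Finset.sum_add_distrib, ← Finset.mul_sum, ← Finset.mul_sum, sum_max_sub_eq_tvDist,
    sum_toReal_eq_one, mul_one, add_comm, div_mul_eq_mul_div]
  gcongr
  norm_num

end ExpectedNorm

/-- The norm estimates that Algorithm 1 asks of `E` fail with probability at most `1 / 120`. -/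
def NormEstimatesCorrect (E : (N : ℕ) → (δ : ℝ) → SampleProg Unit (Fin N) ℝ) : Prop :=
  ∀ (N : ℕ) (p : PMF (Fin N)), prob ((E N (1 / 120)).run fun _ => p)
    {L | l2NormSq p / 2 ≤ L ∧ L ≤ 3 * l2NormSq p / 2}ᶜ ≤ 1 / 120

/-- The closeness tests that Algorithm 1 asks of `T` fail with probability at most `1 / 80`. -/
def ClosenessTestsCorrect (T : (N : ℕ) → (b ε δ : ℝ) → SampleProg Bool (Fin N) Bool) : Prop :=
  ∀ (N : ℕ) (b ε : ℝ), 0 < b → 0 < ε → ε < 1 → ∀ p q : PMF (Fin N),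
    min (l2NormSq p) (l2NormSq q) ≤ b →
    (p = q → prob ((T N b ε (1 / 80)).run fun i => bif i then q else p) {true}ᶜ ≤ 1 / 80) ∧
    (ε ≤ tvDist p q →
      prob ((T N b ε (1 / 80)).run fun i => bif i then q else p) {false}ᶜ ≤ 1 / 80)

theorem prob_compl_le_of_one_sub_le {Ω : Type*} {μ : PMF Ω} {S : Set Ω} {δ : ℝ}
    (h : 1 - δ ≤ prob μ S) : prob μ Sᶜ ≤ δ := by
  linarith [prob_add_prob_compl μ S]

theorem IsL2NormEstimator.normEstimatesCorrect
    {E : (N : ℕ) → (δ : ℝ) → SampleProg Unit (Fin N) ℝ} (hE : IsL2NormEstimator E) :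
    NormEstimatesCorrect E := fun N p =>
  have ⟨_, _, h⟩ := hE
  prob_compl_le_of_one_sub_le ((h N (1 / 120) (by norm_num) (by norm_num)).2 p)

theorem IsClosenessTester.closenessTestsCorrect
    {T : (N : ℕ) → (b ε δ : ℝ) → SampleProg Bool (Fin N) Bool} (hT : IsClosenessTester T) :
    ClosenessTestsCorrect T := by
  obtain ⟨_, _, h⟩ := hT
  intro N b ε hb hε hε' p q hpq
  have h_test := (h N b ε (1 / 80) hb hε hε' (by norm_num) (by norm_num)).2 p q hpq
  rw [← prob_singleton, ← prob_singleton] at h_test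
  exact ⟨fun h => prob_compl_le_of_one_sub_le (h_test.1 h),
    fun h => prob_compl_le_of_one_sub_le (h_test.2 h)⟩

section FlattenedTest

variable (E : (N : ℕ) → (δ : ℝ) → SampleProg Unit (Fin N) ℝ)
  (T : (N : ℕ) → (b ε δ : ℝ) → SampleProg Bool (Fin N) Bool)
  {n m : ℕ} (b₁ : Fin n → ℕ) (b₂ : Fin m → ℕ) [∀ i, NeZero (b₁ i)] [∀ j, NeZero (b₂ j)]
  (τ₁ τ₂ ε : ℝ)

/-- The closeness test of step 5, with its answer turned into a verdict. -/
def flattenedClosenessTest : SampleProg Unit (Fin n × Fin m) Verdict :=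
  (simulate (fun i => bif i then flatSampleProd b₁ b₂ else flatSampleJoint b₁ b₂)
    (T ((∑ i, b₁ i) * ∑ j, b₂ j) (4 * 120 ^ 2 * τ₁ * τ₂) ε (1 / 80))).bind fun closeEnough =>
  ret (bif closeEnough then Verdict.accept else Verdict.reject)

/-- Steps 4 and 5, which follow the two checks of the marginals. -/
def flattenedJointTest : SampleProg Unit (Fin n × Fin m) Verdict :=
  (simulate (fun _ => flatSampleJoint b₁ b₂)
    (E ((∑ i, b₁ i) * ∑ j, b₂ j) (1 / 120))).bind fun L =>
  if L > 10 * 120 ^ 2 * τ₁ * τ₂ then ret Verdict.reject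
  else flattenedClosenessTest T b₁ b₂ τ₁ τ₂ ε

theorem flattenedTest_eq : flattenedTest E T b₁ b₂ τ₁ τ₂ ε =
    (simulate (fun _ => flatSample₁ b₁) (E (∑ i, b₁ i) (1 / 120))).bind fun L₁ =>
    (simulate (fun _ => flatSample₂ b₂) (E (∑ j, b₂ j) (1 / 120))).bind fun L₂ =>
    if L₁ > 120 * τ₁ ∨ L₂ > 120 * τ₂ then ret Verdict.inaccurate
    else flattenedJointTest E T b₁ b₂ τ₁ τ₂ ε := rfl

theorem run_flattenedTest (p : PMF (Fin n × Fin m)) :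
    (flattenedTest E T b₁ b₂ τ₁ τ₂ ε).run (fun _ => p) =
    ((E _ (1 / 120)).run fun _ => flattening b₁ (p.map Prod.fst)).bind fun L₁ =>
    ((E _ (1 / 120)).run fun _ => flattening b₂ (p.map Prod.snd)).bind fun L₂ =>
    (if L₁ > 120 * τ₁ ∨ L₂ > 120 * τ₂ then ret Verdict.inaccurate
      else flattenedJointTest E T b₁ b₂ τ₁ τ₂ ε).run fun _ => p := by
  rw [flattenedTest_eq, run_bind]
  simp only [run_bind, run_simulate, run_flatSample₁, run_flatSample₂]

theorem run_flattenedClosenessTest (p : PMF (Fin n × Fin m)) :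
    (flattenedClosenessTest T b₁ b₂ τ₁ τ₂ ε).run (fun _ => p) =
    ((T _ (4 * 120 ^ 2 * τ₁ * τ₂) ε (1 / 80)).run fun i =>
      bif i then
        (prodPMF (flattening b₁ (p.map Prod.fst)) (flattening b₂ (p.map Prod.snd))).map
          finProdFinEquiv
      else (jointFlattening b₁ b₂ p).map finProdFinEquiv).map
    fun closeEnough => bif closeEnough then Verdict.accept else Verdict.reject := by
  rw [flattenedClosenessTest, run_bind_ret, run_simulate]
  congr 2
  ext1 i
  cases i
  · exact run_flatSampleJoint b₁ b₂ p
  · exact run_flatSampleProd b₁ b₂ p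

variable {E T τ₁ τ₂ ε} (p : PMF (Fin n × Fin m))

theorem l2NormSq_prodPMF_flattening_le (hτ₁ : 0 < τ₁)
    (h₁ : l2NormSq (flattening b₁ (p.map Prod.fst)) ≤ 240 * τ₁)
    (h₂ : l2NormSq (flattening b₂ (p.map Prod.snd)) ≤ 240 * τ₂) :
    l2NormSq (prodPMF (flattening b₁ (p.map Prod.fst)) (flattening b₂ (p.map Prod.snd)))
      ≤ 4 * 120 ^ 2 * τ₁ * τ₂ := by
  rw [l2NormSq_prodPMF]
  exact (mul_le_mul h₁ h₂ (l2NormSq_nonneg _) (by positivity)).trans (le_of_eq (by ring))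

theorem jointFlattening_eq_of_isProductDist (hp : IsProductDist p) :
    jointFlattening b₁ b₂ p
      = prodPMF (flattening b₁ (p.map Prod.fst)) (flattening b₂ (p.map Prod.snd)) := by
  rw [← jointFlattening_prodPMF, (isProductDist_iff p).1 hp]

theorem le_tvDist_of_isFarFromProduct (hp : IsFarFromProduct ε p) :
    ε ≤ tvDist (jointFlattening b₁ b₂ p)
      (prodPMF (flattening b₁ (p.map Prod.fst)) (flattening b₂ (p.map Prod.snd))) := by
  rw [← jointFlattening_prodPMF, tvDist_jointFlattening]
  exact hp _ ⟨_, _, prodPMF_apply _ _⟩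

theorem prob_ret_eq_zero {ι X R : Type} {q : ι → PMF X} {r r' : R} (h : r ≠ r') :
    prob ((ret r : SampleProg ι X R).run q) {r'} = 0 :=
  prob_pure_of_notMem h

theorem prob_flattenedTest_le (hE : NormEstimatesCorrect E) {v : Verdict}
    (hv : Verdict.inaccurate ≠ v) {c : ℝ} (hc : 0 ≤ c)
    (h : l2NormSq (flattening b₁ (p.map Prod.fst)) ≤ 240 * τ₁ →
      l2NormSq (flattening b₂ (p.map Prod.snd)) ≤ 240 * τ₂ →
      prob ((flattenedJointTest E T b₁ b₂ τ₁ τ₂ ε).run fun _ => p) {v} ≤ c) :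
    prob ((flattenedTest E T b₁ b₂ τ₁ τ₂ ε).run fun _ => p) {v} ≤ 1 / 120 + c := by
  have hc' : 0 ≤ 1 / 120 + c := by positivity
  rw [run_flattenedTest]
  by_cases h₁ : l2NormSq (flattening b₁ (p.map Prod.fst)) ≤ 240 * τ₁
  · refine prob_bind_le _ hc' fun L₁ => ?_
    by_cases h₂ : l2NormSq (flattening b₂ (p.map Prod.snd)) ≤ 240 * τ₂
    · refine prob_bind_le _ hc' fun L₂ => ?_
      split_ifs
      · exact (prob_ret_eq_zero hv).trans_le hc'
      · linarith [h h₁ h₂]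
    · refine (prob_bind_le_add _ hc fun L₂ hL₂ => ?_).trans (add_le_add_left (hE _ _) c)
      rw [Set.notMem_compl_iff, Set.mem_ofPred_eq] at hL₂
      rw [if_pos (Or.inr (by linarith [hL₂.1]))]
      exact (prob_ret_eq_zero hv).trans_le hc
  · refine (prob_bind_le_add _ hc fun L₁ hL₁ => ?_).trans (add_le_add_left (hE _ _) c)
    rw [Set.notMem_compl_iff, Set.mem_ofPred_eq] at hL₁
    refine prob_bind_le _ hc fun L₂ => ?_
    rw [if_pos (Or.inl (by linarith [hL₁.1]))]
    exact (prob_ret_eq_zero hv).trans_le hc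

theorem prob_flattenedClosenessTest_reject_le (hT : ClosenessTestsCorrect T) (hτ₁ : 0 < τ₁)
    (hτ₂ : 0 < τ₂) (hε : 0 < ε) (hε' : ε < 1) (hp : IsProductDist p)
    (h₁ : l2NormSq (flattening b₁ (p.map Prod.fst)) ≤ 240 * τ₁)
    (h₂ : l2NormSq (flattening b₂ (p.map Prod.snd)) ≤ 240 * τ₂) :
    prob ((flattenedClosenessTest T b₁ b₂ τ₁ τ₂ ε).run fun _ => p) {Verdict.reject} ≤ 1 / 80 := by
  rw [run_flattenedClosenessTest, prob_map]
  refine (prob_mono _ ?_).trans ((hT _ _ ε (by positivity) hε hε' _ _ (min_le_iff.2 (Or.inr ?_))).1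
    (by rw [jointFlattening_eq_of_isProductDist b₁ b₂ p hp]))
  · rintro (_ | _) <;> simp
  · exact (l2NormSq_map_equiv _ _).trans_le (l2NormSq_prodPMF_flattening_le b₁ b₂ p hτ₁ h₁ h₂)

theorem prob_flattenedClosenessTest_accept_le (hT : ClosenessTestsCorrect T) (hτ₁ : 0 < τ₁)
    (hτ₂ : 0 < τ₂) (hε : 0 < ε) (hε' : ε < 1) (hp : IsFarFromProduct ε p)
    (h₁ : l2NormSq (flattening b₁ (p.map Prod.fst)) ≤ 240 * τ₁)
    (h₂ : l2NormSq (flattening b₂ (p.map Prod.snd)) ≤ 240 * τ₂) :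
    prob ((flattenedClosenessTest T b₁ b₂ τ₁ τ₂ ε).run fun _ => p) {Verdict.accept} ≤ 1 / 80 := by
  rw [run_flattenedClosenessTest, prob_map]
  refine (prob_mono _ ?_).trans ((hT _ _ ε (by positivity) hε hε' _ _ (min_le_iff.2 (Or.inr ?_))).2
    ((le_tvDist_of_isFarFromProduct b₁ b₂ p hp).trans_eq (tvDist_map_equiv _ _ _).symm))
  · rintro (_ | _) <;> simp
  · exact (l2NormSq_map_equiv _ _).trans_le (l2NormSq_prodPMF_flattening_le b₁ b₂ p hτ₁ h₁ h₂)

theorem prob_flattenedTest_reject_le (hE : NormEstimatesCorrect E) (hT : ClosenessTestsCorrect T)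
    (hτ₁ : 0 < τ₁) (hτ₂ : 0 < τ₂) (hε : 0 < ε) (hε' : ε < 1) (hp : IsProductDist p) :
    prob ((flattenedTest E T b₁ b₂ τ₁ τ₂ ε).run fun _ => p) {Verdict.reject}
      ≤ 1 / 120 + (1 / 120 + 1 / 80) := by
  refine prob_flattenedTest_le b₁ b₂ p hE (by simp) (by norm_num) fun h₁ h₂ => ?_
  have h_norm : l2NormSq ((jointFlattening b₁ b₂ p).map finProdFinEquiv)
      ≤ 4 * 120 ^ 2 * τ₁ * τ₂ := by
    rw [l2NormSq_map_equiv, jointFlattening_eq_of_isProductDist b₁ b₂ p hp]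
    exact l2NormSq_prodPMF_flattening_le b₁ b₂ p hτ₁ h₁ h₂
  have hτ : 0 < τ₁ * τ₂ := mul_pos hτ₁ hτ₂
  rw [flattenedJointTest, run_bind, run_simulate]
  simp only [run_flatSampleJoint]
  refine (prob_bind_le_add _ (by norm_num) fun L hL => ?_).trans (add_le_add_left (hE _ _) _)
  rw [Set.notMem_compl_iff, Set.mem_ofPred_eq] at hL
  rw [if_neg (by push Not; linarith [hL.2])]
  exact prob_flattenedClosenessTest_reject_le b₁ b₂ p hT hτ₁ hτ₂ hε hε' hp h₁ h₂

theorem prob_flattenedTest_accept_le (hE : NormEstimatesCorrect E) (hT : ClosenessTestsCorrect T)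
    (hτ₁ : 0 < τ₁) (hτ₂ : 0 < τ₂) (hε : 0 < ε) (hε' : ε < 1) (hp : IsFarFromProduct ε p) :
    prob ((flattenedTest E T b₁ b₂ τ₁ τ₂ ε).run fun _ => p) {Verdict.accept}
      ≤ 1 / 120 + 1 / 80 := by
  refine prob_flattenedTest_le b₁ b₂ p hE (by simp) (by norm_num) fun h₁ h₂ => ?_
  rw [flattenedJointTest, run_bind]
  refine prob_bind_le _ (by norm_num) fun L => ?_
  split_ifs
  · exact (prob_ret_eq_zero (by simp)).trans_le (by norm_num)
  · exact prob_flattenedClosenessTest_accept_le b₁ b₂ p hT hτ₁ hτ₂ hε hε' hp h₁ h₂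

theorem prob_flattenedJointTest_inaccurate :
    prob ((flattenedJointTest E T b₁ b₂ τ₁ τ₂ ε).run fun _ => p) {Verdict.inaccurate} = 0 := by
  refine le_antisymm ?_ (prob_nonneg _ _)
  rw [flattenedJointTest, run_bind]
  refine prob_bind_le _ le_rfl fun L => ?_
  split_ifs
  · exact (prob_ret_eq_zero (by simp)).le
  · rw [flattenedClosenessTest, run_bind]
    exact prob_bind_le _ le_rfl fun c => (prob_ret_eq_zero (by cases c <;> simp)).le

theorem prob_flattenedTest_inaccurate_le_of_l2NormSq_le (hE : NormEstimatesCorrect E)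
    (h₁ : l2NormSq (flattening b₁ (p.map Prod.fst)) ≤ 80 * τ₁)
    (h₂ : l2NormSq (flattening b₂ (p.map Prod.snd)) ≤ 80 * τ₂) :
    prob ((flattenedTest E T b₁ b₂ τ₁ τ₂ ε).run fun _ => p) {Verdict.inaccurate} ≤ 1 / 60 := by
  rw [run_flattenedTest, show (1 / 60 : ℝ) = 1 / 120 + (1 / 120 + 0) by norm_num]
  refine (prob_bind_le_add _ (by norm_num) fun L₁ hL₁ => ?_).trans (add_le_add_left (hE _ _) _)
  refine (prob_bind_le_add _ le_rfl fun L₂ hL₂ => ?_).trans (add_le_add_left (hE _ _) _)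
  rw [Set.notMem_compl_iff, Set.mem_ofPred_eq] at hL₁ hL₂
  rw [if_neg (by push Not; constructor <;> linarith [hL₁.2, hL₂.2])]
  exact (prob_flattenedJointTest_inaccurate b₁ b₂ p).le

theorem prob_flattenedTest_inaccurate_le (hE : NormEstimatesCorrect E) (hτ₁ : 0 < τ₁)
    (hτ₂ : 0 < τ₂) :
    prob ((flattenedTest E T b₁ b₂ τ₁ τ₂ ε).run fun _ => p) {Verdict.inaccurate}
      ≤ 1 / 60 + (l2NormSq (flattening b₁ (p.map Prod.fst)) / (80 * τ₁)
        + l2NormSq (flattening b₂ (p.map Prod.snd)) / (80 * τ₂)) := by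
  have h_nonneg₁ : 0 ≤ l2NormSq (flattening b₁ (p.map Prod.fst)) / (80 * τ₁) :=
    div_nonneg (l2NormSq_nonneg _) (by positivity)
  have h_nonneg₂ : 0 ≤ l2NormSq (flattening b₂ (p.map Prod.snd)) / (80 * τ₂) :=
    div_nonneg (l2NormSq_nonneg _) (by positivity)
  have h_one := prob_le_one ((flattenedTest E T b₁ b₂ τ₁ τ₂ ε).run fun _ => p) {Verdict.inaccurate}
  rcases le_or_gt (l2NormSq (flattening b₁ (p.map Prod.fst))) (80 * τ₁) with h₁ | h₁
  · rcases le_or_gt (l2NormSq (flattening b₂ (p.map Prod.snd))) (80 * τ₂) with h₂ | h₂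
    · linarith [prob_flattenedTest_inaccurate_le_of_l2NormSq_le (T := T) (ε := ε) b₁ b₂ p hE h₁ h₂]
    · linarith [(one_le_div (by positivity)).2 h₂.le]
  · linarith [(one_le_div (by positivity)).2 h₁.le]

end FlattenedTest

section PoissonizedTest

variable {n m : ℕ} (s₁ s₂ : ℝ)
  (Q : List (Fin n) → List (Fin m) → SampleProg Unit (Fin n × Fin m) Verdict)

/-- Steps 1 and 2: feed Poisson numbers of samples from the two marginals to the test `Q`, but
reject if there are too many of them. -/
def poissonizedTest : SampleProg Unit (Fin n × Fin m) Verdict :=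
  (random (poisson s₁)).bind fun t₁ =>
  (random (poisson s₂)).bind fun t₂ =>
  if (t₁ : ℝ) > 160 * s₁ ∨ (t₂ : ℝ) > 160 * s₂ then ret Verdict.reject
  else (samples () t₁).bind fun S₁ => (samples () t₂).bind fun S₂ =>
    Q (S₁.map Prod.fst) (S₂.map Prod.snd)

variable {s₁ s₂ Q} (p : PMF (Fin n × Fin m))

theorem prob_poissonizedTest_reject_le (hs₁ : 0 ≤ s₁) (hs₂ : 0 ≤ s₂) {c : ℝ} (hc : 0 ≤ c)
    (hQ : ∀ l₁ l₂, prob ((Q l₁ l₂).run fun _ => p) {Verdict.reject} ≤ c) :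
    prob ((poissonizedTest s₁ s₂ Q).run fun _ => p) {Verdict.reject}
      ≤ 1 / 160 + (1 / 160 + c) := by
  rw [poissonizedTest, run_bind, run_random]
  refine (prob_bind_le_add _ (by positivity) fun t₁ ht₁ => ?_).trans
    (add_le_add_left (prob_poisson_gt_le hs₁) _)
  rw [run_bind, run_random]
  refine (prob_bind_le_add _ hc fun t₂ ht₂ => ?_).trans
    (add_le_add_left (prob_poisson_gt_le hs₂) _)
  rw [Set.mem_ofPred_eq] at ht₁ ht₂
  rw [if_neg (not_or.2 ⟨ht₁, ht₂⟩), run_bind]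
  refine prob_bind_le _ hc fun S₁ => ?_
  rw [run_bind]
  exact prob_bind_le _ hc fun S₂ => hQ _ _

theorem ofReal_prob_poissonizedTest_le {v : Verdict} (hv : Verdict.reject ≠ v) :
    ENNReal.ofReal (prob ((poissonizedTest s₁ s₂ Q).run fun _ => p) {v})
      ≤ expect (poissonSamples (p.map Prod.fst) s₁) fun l₁ =>
          expect (poissonSamples (p.map Prod.snd) s₂) fun l₂ =>
            ENNReal.ofReal (prob ((Q l₁ l₂).run fun _ => p) {v}) := by
  simp only [← poissonSamples_map, expect_map, Function.comp_def, expect_poissonSamples]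
  rw [poissonizedTest, run_bind, run_random, ofReal_prob_bind]
  refine expect_mono _ fun t₁ => ?_
  rw [expect_comm, run_bind, run_random, ofReal_prob_bind]
  refine expect_mono _ fun t₂ => ?_
  split_ifs
  · rw [prob_ret_eq_zero hv, ENNReal.ofReal_zero]
    exact zero_le
  · rw [run_bind, run_samples, ofReal_prob_bind, expect_map]
    refine expect_mono _ fun v₁ => ?_
    rw [Function.comp_apply, run_bind, run_samples, ofReal_prob_bind, expect_map]
    rfl

end PoissonizedTest

/-- The expected number `s₁` of samples that refine the flattening of the first marginal. -/
def firstRate (n m : ℕ) (α ε : ℝ) : ℝ :=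
  min ((n : ℝ) ^ (2 / 3 : ℝ) * (m : ℝ) ^ (1 / 3 : ℝ) * α ^ (1 / 3 : ℝ) * ε ^ (-4 / 3 : ℝ)) (n * α)

section Tester

variable {E : (N : ℕ) → (δ : ℝ) → SampleProg Unit (Fin N) ℝ}
  {T : (N : ℕ) → (b ε δ : ℝ) → SampleProg Bool (Fin N) Bool} {n m : ℕ} {α ε : ℝ}

theorem firstRate_nonneg (hε : 0 ≤ ε) (hα : 0 ≤ α) : 0 ≤ firstRate n m α ε :=
  le_min (by positivity) (by positivity)

theorem eq_zero_of_firstRate_eq_zero (hn : 0 < n) (hm : 0 < m) (hε : 0 < ε) (hα : 0 ≤ α)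
    (h : firstRate n m α ε = 0) : α = 0 := by
  by_contra hα'
  have : 0 < α := hα.lt_of_ne' hα'
  exact h.not_gt (lt_min (by positivity) (by positivity))

theorem augIndependenceTester_eq (phat : PMF (Fin n × Fin m)) :
    augIndependenceTester E T n m α ε phat
      = poissonizedTest (firstRate n m α ε) (m * α) fun l₁ l₂ =>
        flattenedTest E T (buckets (phat.map Prod.fst) l₁) (buckets (phat.map Prod.snd) l₂)
          (2 * α / firstRate n m α ε + 4 / n) (2 * α / (m * α) + 4 / m) ε := rfl

theorem threshold_pos {s : ℝ} (hn : 0 < n) (hα : 0 ≤ α) (hs : 0 ≤ s) : 0 < 2 * α / s + 4 / n := by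
  positivity

theorem prob_augIndependenceTester_reject_le (hE : NormEstimatesCorrect E)
    (hT : ClosenessTestsCorrect T) (hn : 0 < n) (hm : 0 < m) (hε : 0 < ε) (hε' : ε < 1)
    (hα : 0 ≤ α) {p : PMF (Fin n × Fin m)} (hp : IsProductDist p) (phat : PMF (Fin n × Fin m)) :
    prob ((augIndependenceTester E T n m α ε phat).run fun _ => p) {Verdict.reject} ≤ 1 / 20 := by
  have hs₁ : 0 ≤ firstRate n m α ε := firstRate_nonneg hε.le hα
  have hs₂ : 0 ≤ m * α := by positivity
  rw [augIndependenceTester_eq]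
  refine (prob_poissonizedTest_reject_le p hs₁ hs₂ (by norm_num) fun l₁ l₂ =>
    prob_flattenedTest_reject_le _ _ p hE hT (threshold_pos hn hα hs₁) (threshold_pos hm hα hs₂)
      hε hε' hp).trans (by norm_num)

theorem prob_augIndependenceTester_accept_le (hE : NormEstimatesCorrect E)
    (hT : ClosenessTestsCorrect T) (hn : 0 < n) (hm : 0 < m) (hε : 0 < ε) (hε' : ε < 1)
    (hα : 0 ≤ α) {p : PMF (Fin n × Fin m)} (hp : IsFarFromProduct ε p)
    (phat : PMF (Fin n × Fin m)) :
    prob ((augIndependenceTester E T n m α ε phat).run fun _ => p) {Verdict.accept} ≤ 1 / 20 := by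
  have hs₁ : 0 ≤ firstRate n m α ε := firstRate_nonneg hε.le hα
  have hs₂ : 0 ≤ m * α := by positivity
  rw [← ENNReal.ofReal_le_ofReal_iff (by norm_num), augIndependenceTester_eq]
  refine (ofReal_prob_poissonizedTest_le p (by simp)).trans
    (expect_le_of_le _ fun l₁ => expect_le_of_le _ fun l₂ => ENNReal.ofReal_le_ofReal ?_)
  exact (prob_flattenedTest_accept_le _ _ p hE hT (threshold_pos hn hα hs₁)
    (threshold_pos hm hα hs₂) hε hε' hp).trans (by norm_num)

theorem expect_ofReal_div_le {Ω : Type*} (μ : PMF Ω) {f : Ω → ℝ} {c M : ℝ} (hc : 0 < c)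
    (hf : expect μ (fun x => ENNReal.ofReal (f x)) ≤ ENNReal.ofReal M) :
    expect μ (fun x => ENNReal.ofReal (f x / c)) ≤ ENNReal.ofReal (M / c) := by
  simp only [ENNReal.ofReal_div_of_pos hc]
  simp only [div_eq_mul_inv, expect_mul_const]
  gcongr

theorem expect_flattening_div_le (hn : 0 < n) {s : ℝ} (hs : 0 ≤ s) (hs' : s = 0 → α = 0)
    (hα : 0 ≤ α) {p q : PMF (Fin n)} (h_tv : tvDist p q ≤ α) :
    expect (poissonSamples p s) (fun l =>
      ENNReal.ofReal (l2NormSq (flattening (buckets q l) p) / (80 * (2 * α / s + 4 / n))))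
      ≤ ENNReal.ofReal (1 / 80) := by
  have : 0 < 2 * α / s + 4 / n := threshold_pos hn hα hs
  refine (expect_ofReal_div_le _ (by positivity)
    (expect_l2NormSq_flattening_le hs hs' h_tv)).trans_eq ?_
  congr 1
  field_simp

theorem prob_augIndependenceTester_inaccurate_le (hE : NormEstimatesCorrect E) (hn : 0 < n)
    (hm : 0 < m) (hε : 0 < ε) (hα : 0 ≤ α) {p phat : PMF (Fin n × Fin m)}
    (h_tv : tvDist p phat ≤ α) :
    prob ((augIndependenceTester E T n m α ε phat).run fun _ => p) {Verdict.inaccurate}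
      ≤ 1 / 20 := by
  have hs₁ : 0 ≤ firstRate n m α ε := firstRate_nonneg hε.le hα
  have hs₂ : 0 ≤ m * α := by positivity
  have hs₂' : m * α = 0 → α = 0 := fun h => (mul_eq_zero.1 h).resolve_left (by positivity)
  have h_flat₁ := expect_flattening_div_le hn hs₁ (eq_zero_of_firstRate_eq_zero hn hm hε hα) hα
    ((tvDist_map_le p phat Prod.fst).trans h_tv)
  have h_flat₂ := expect_flattening_div_le hm hs₂ hs₂' hα
    ((tvDist_map_le p phat Prod.snd).trans h_tv)
  have h_sum : ENNReal.ofReal (1 / 60) + (ENNReal.ofReal (1 / 80) + ENNReal.ofReal (1 / 80))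
      ≤ ENNReal.ofReal (1 / 20) := by
    rw [← ENNReal.ofReal_add (by norm_num) (by norm_num),
      ← ENNReal.ofReal_add (by norm_num) (by norm_num)]
    exact ENNReal.ofReal_le_ofReal (by norm_num)
  rw [← ENNReal.ofReal_le_ofReal_iff (by norm_num), augIndependenceTester_eq]
  refine (ofReal_prob_poissonizedTest_le p (by simp)).trans (le_trans
    (expect_mono _ fun l₁ => expect_mono _ fun l₂ =>
      (ENNReal.ofReal_le_ofReal (prob_flattenedTest_inaccurate_le _ _ p hE
        (threshold_pos hn hα hs₁) (threshold_pos hm hα hs₂))).trans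
      (ENNReal.ofReal_add_le.trans (add_le_add_right ENNReal.ofReal_add_le _))) ?_)
  simp only [expect_add, expect_const]
  exact (add_le_add_right (add_le_add h_flat₁ h_flat₂) _).trans h_sum

theorem isAugIndependenceTester_augIndependenceTester (hE : NormEstimatesCorrect E)
    (hT : ClosenessTestsCorrect T) (hn : 0 < n) (hm : 0 < m) (hε : 0 < ε) (hε' : ε < 1)
    (hα : 0 ≤ α) : IsAugIndependenceTester α ε 0.1 (augIndependenceTester E T n m α ε) := by
  intro p phat
  simp only [← prob_singleton, show (0.1 / 2 : ℝ) = 1 / 20 by norm_num]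
  exact ⟨fun hp => prob_augIndependenceTester_reject_le hE hT hn hm hε hε' hα hp phat,
    fun hp => prob_augIndependenceTester_accept_le hE hT hn hm hε hε' hα hp phat,
    prob_augIndependenceTester_inaccurate_le hE hn hm hε hα⟩

end Tester

/-- The term `n^(2/3) m^(1/3) α^(1/3) / ε^(4/3)` of the sample bound, the price of a prediction
error `α`. -/
def flatteningCost (n m : ℕ) (α ε : ℝ) : ℝ :=
  (n : ℝ) ^ (2 / 3 : ℝ) * (m : ℝ) ^ (1 / 3 : ℝ) * α ^ (1 / 3 : ℝ) / ε ^ (4 / 3 : ℝ)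

/-- The sample bound of the theorem, up to the constant. -/
def sampleBound (n m : ℕ) (α ε : ℝ) : ℝ :=
  max (√((n : ℝ) * m) / ε ^ 2) (flatteningCost n m α ε)

section Bounds

variable {n m : ℕ} {α ε : ℝ}

theorem flatteningCost_nonneg (hα : 0 ≤ α) (hε : 0 ≤ ε) : 0 ≤ flatteningCost n m α ε := by
  unfold flatteningCost
  positivity

theorem firstRate_eq (hε : 0 ≤ ε) :
    firstRate n m α ε = min (flatteningCost n m α ε) (n * α) := by
  rw [firstRate, flatteningCost, neg_div, Real.rpow_neg hε, ← div_eq_mul_inv]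

theorem flatteningCost_cube (hα : 0 ≤ α) (hε : 0 < ε) :
    flatteningCost n m α ε ^ 3 * ε ^ 4 = n ^ 2 * m * α := by
  have rpow_cube : ∀ (x y : ℝ) (k : ℕ), 0 ≤ x → y * (3 : ℕ) = k → (x ^ y) ^ 3 = x ^ k :=
    fun x y k hx hy => by rw [← Real.rpow_mul_natCast hx, hy, Real.rpow_natCast]
  rw [flatteningCost, div_pow, mul_pow, mul_pow,
    rpow_cube n _ 2 (by positivity) (by norm_num), rpow_cube m _ 1 (by positivity) (by norm_num),
    rpow_cube α _ 1 hα (by norm_num), rpow_cube ε _ 4 hε.le (by norm_num)]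
  field_simp

theorem sqrt_le_sampleBound (hε : 0 < ε) (hε' : ε ≤ 1) :
    √((n : ℝ) * m) ≤ sampleBound n m α ε :=
  (le_div_self (Real.sqrt_nonneg _) (by positivity) (pow_le_one₀ hε.le hε')).trans
    (le_max_left _ _)

theorem mul_le_sq_sampleBound_mul (hε : 0 < ε) :
    (n : ℝ) * m ≤ (sampleBound n m α ε * ε ^ 2) ^ 2 := by
  have h_sqrt : √((n : ℝ) * m) ≤ sampleBound n m α ε * ε ^ 2 :=
    (div_le_iff₀ (by positivity)).1 (le_max_left _ _)
  exact (Real.sqrt_le_left ((Real.sqrt_nonneg _).trans h_sqrt)).1 h_sqrt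

theorem div_flatteningCost_le (hα : 0 ≤ α) (hε : 0 < ε) :
    (n : ℝ) ^ 2 * m * (2 * α / flatteningCost n m α ε)
      ≤ 2 * (flatteningCost n m α ε ^ 2 * ε ^ 4) := by
  have h_cube := flatteningCost_cube (n := n) (m := m) hα hε
  rcases (flatteningCost_nonneg (n := n) (m := m) hα hε.le).eq_or_lt with h | h
  · rw [← h, div_zero, mul_zero]
    positivity
  · rw [← mul_div_assoc, div_le_iff₀ h]
    linarith

theorem mul_div_mul_self_le (hα : 0 ≤ α) : (n : ℝ) * (2 * α / (n * α)) ≤ 2 := by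
  rw [← mul_div_assoc]
  exact div_le_of_le_mul₀ (by positivity) zero_le_two (by linarith)

theorem mul_four_div_self_le : (n : ℝ) * (4 / n) ≤ 4 := by
  rw [← mul_div_assoc]
  exact div_le_of_le_mul₀ n.cast_nonneg zero_le_four (by linarith)

theorem firstThreshold_le (hε : 0 < ε) (hα : 0 ≤ α) :
    (n : ℝ) ^ 2 * m * (2 * α / firstRate n m α ε + 4 / n)
      ≤ 2 * (flatteningCost n m α ε ^ 2 * ε ^ 4) + 6 * (n * m) := by
  have h_four : (n : ℝ) * m * (n * (4 / n)) ≤ n * m * 4 := by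
    gcongr
    exact mul_four_div_self_le
  suffices h_two : (n : ℝ) ^ 2 * m * (2 * α / firstRate n m α ε)
      ≤ 2 * (flatteningCost n m α ε ^ 2 * ε ^ 4) + 2 * (n * m) by linarith
  rw [firstRate_eq hε.le]
  rcases min_choice (flatteningCost n m α ε) (n * α) with h | h <;> rw [h]
  · exact (div_flatteningCost_le hα hε).trans (le_add_of_nonneg_right (by positivity))
  · have h_rate : (n : ℝ) * m * (n * (2 * α / (n * α))) ≤ n * m * 2 := by
      gcongr
      exact mul_div_mul_self_le hα
    have h_cost : 0 ≤ flatteningCost n m α ε ^ 2 * ε ^ 4 := by positivity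
    linarith

theorem secondThreshold_le (hα : 0 ≤ α) : (m : ℝ) * (2 * α / (m * α) + 4 / m) ≤ 6 := by
  linarith [mul_div_mul_self_le (n := m) hα, mul_four_div_self_le (n := m)]

theorem closenessCost_le (hε : 0 < ε) (hα : 0 ≤ α) :
    (n : ℝ) * m * √((2 * α / firstRate n m α ε + 4 / n) * (2 * α / (m * α) + 4 / m)) / ε ^ 2
      ≤ 7 * sampleBound n m α ε := by
  have : 0 ≤ firstRate n m α ε := firstRate_nonneg hε.le hα
  have h_cost : 0 ≤ flatteningCost n m α ε := flatteningCost_nonneg hα hε.le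
  have h_first := firstThreshold_le (n := n) (m := m) hε hα
  have h_second := secondThreshold_le (m := m) hα
  have h_nm := mul_le_sq_sampleBound_mul (n := n) (m := m) (α := α) hε
  have h_cost_le : flatteningCost n m α ε ≤ sampleBound n m α ε := le_max_right _ _
  have h_second_nonneg : 0 ≤ (m : ℝ) * (2 * α / (m * α) + 4 / m) := by positivity
  generalize 2 * α / firstRate n m α ε + 4 / n = τ₁ at *
  generalize 2 * α / (m * α) + 4 / m = τ₂ at *
  generalize flatteningCost n m α ε = A at *
  generalize sampleBound n m α ε = M at *
  have hM : 0 ≤ M := h_cost.trans h_cost_le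
  have h_sq : A ^ 2 * ε ^ 4 ≤ M ^ 2 * ε ^ 4 := by gcongr
  rw [div_le_iff₀ (by positivity), ← Real.sqrt_sq (by positivity : 0 ≤ (n : ℝ) * m),
    ← Real.sqrt_mul (by positivity)]
  refine Real.sqrt_le_iff.2 ⟨by positivity, ?_⟩
  calc ((n : ℝ) * m) ^ 2 * (τ₁ * τ₂)
      = (n ^ 2 * m * τ₁) * (m * τ₂) := by ring
    _ ≤ (2 * (A ^ 2 * ε ^ 4) + 6 * (n * m)) * 6 := by gcongr
    _ ≤ (2 * (M ^ 2 * ε ^ 4) + 6 * (M * ε ^ 2) ^ 2) * 6 := by gcongr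
    _ = 48 * (M * ε ^ 2) ^ 2 := by ring
    _ ≤ (7 * M * ε ^ 2) ^ 2 := by linarith [sq_nonneg (M * ε ^ 2)]

end Bounds

theorem natCast_mul_le_sq_mul {n m B₁ B₂ : ℕ} {c : ℝ} (h₁ : (B₁ : ℝ) ≤ c * n)
    (h₂ : (B₂ : ℝ) ≤ c * m) : ((B₁ * B₂ : ℕ) : ℝ) ≤ c ^ 2 * (n * m) := by
  rw [Nat.cast_mul]
  exact (mul_le_mul h₁ h₂ B₂.cast_nonneg (B₁.cast_nonneg.trans h₁)).trans_eq (by ring)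

theorem sum_buckets_le {n : ℕ} (q : PMF (Fin n)) (l : List (Fin n)) :
    ((∑ i, buckets q l i : ℕ) : ℝ) ≤ 2 * n + l.length := by
  have h_count : ∑ i, l.count i = l.length := by
    simpa using Multiset.sum_count_eq_card (s := Finset.univ) (m := (l : Multiset (Fin n)))
      fun a _ => Finset.mem_univ a
  have h_floor : ∑ i, (⌊(n : ℝ) * (q i).toReal⌋₊ : ℝ) ≤ n := by
    calc ∑ i, (⌊(n : ℝ) * (q i).toReal⌋₊ : ℝ) ≤ ∑ i, (n : ℝ) * (q i).toReal :=
          Finset.sum_le_sum fun i _ => Nat.floor_le (by positivity)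
      _ = n := by rw [← Finset.mul_sum, sum_toReal_eq_one, mul_one]
  simp only [buckets, Finset.sum_add_distrib, h_count, Finset.sum_const, Finset.card_univ,
    Fintype.card_fin, smul_eq_mul, mul_one, Nat.cast_add, Nat.cast_sum]
  linarith

theorem usesAtMost_poissonizedTest {n m : ℕ} {s₁ s₂ d : ℝ}
    {Q : List (Fin n) → List (Fin m) → SampleProg Unit (Fin n × Fin m) Verdict}
    (hs₁ : 0 ≤ s₁) (hs₂ : 0 ≤ s₂) (hd : 0 ≤ d)
    (hQ : ∀ l₁ l₂, (l₁.length : ℝ) ≤ 160 * s₁ → (l₂.length : ℝ) ≤ 160 * s₂ →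
      (Q l₁ l₂).UsesAtMost d) :
    (poissonizedTest s₁ s₂ Q).UsesAtMost (160 * s₁ + (160 * s₂ + d)) := by
  refine UsesAtMost.random_bind _ (by positivity) fun t₁ =>
    UsesAtMost.random_bind _ (by positivity) fun t₂ => ?_
  split_ifs with ht
  · exact UsesAtMost.ret _ (by positivity)
  · push Not at ht
    refine UsesAtMost.mono (a := t₁ + (t₂ + d)) ?_ (by linarith [ht.1, ht.2])
    refine UsesAtMost.samples_bind _ _ (by positivity) fun S₁ hS₁ =>
      UsesAtMost.samples_bind _ _ hd fun S₂ hS₂ => hQ _ _ ?_ ?_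
    · rw [List.length_map, hS₁]
      exact ht.1
    · rw [List.length_map, hS₂]
      exact ht.2

theorem IsL2NormEstimator.exists_usesAtMost
    {E : (N : ℕ) → (δ : ℝ) → SampleProg Unit (Fin N) ℝ} (hE : IsL2NormEstimator E) :
    ∃ C : ℝ, 0 ≤ C ∧ ∀ N : ℕ, (E N (1 / 120)).UsesAtMost (C * √N) := by
  obtain ⟨C, hC, h⟩ := hE
  have : 0 ≤ Real.log (1 / (1 / 120)) := Real.log_nonneg (by norm_num)
  exact ⟨C * Real.log (1 / (1 / 120)), by positivity, fun N =>
    (h N (1 / 120) (by norm_num) (by norm_num)).1.mono (le_of_eq (by ring))⟩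

theorem IsClosenessTester.exists_usesAtMost
    {T : (N : ℕ) → (b ε δ : ℝ) → SampleProg Bool (Fin N) Bool} (hT : IsClosenessTester T) :
    ∃ C : ℝ, 0 ≤ C ∧ ∀ (N : ℕ) (b ε : ℝ), 0 < b → 0 < ε → ε < 1 →
      (T N b ε (1 / 80)).UsesAtMost (C * (N * √b / ε ^ 2)) := by
  obtain ⟨C, hC, h⟩ := hT
  have : 0 ≤ Real.log (1 / (1 / 80)) := Real.log_nonneg (by norm_num)
  exact ⟨C * Real.log (1 / (1 / 80)), by positivity, fun N b ε hb hε hε' =>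
    (h N b ε (1 / 80) hb hε hε' (by norm_num) (by norm_num)).1.mono (le_of_eq (by ring))⟩

section TesterCost

variable {E : (N : ℕ) → (δ : ℝ) → SampleProg Unit (Fin N) ℝ}
  {T : (N : ℕ) → (b ε δ : ℝ) → SampleProg Bool (Fin N) Bool} {CE CT : ℝ}

section FlattenedTest

variable {n m : ℕ} (b₁ : Fin n → ℕ) (b₂ : Fin m → ℕ) [∀ i, NeZero (b₁ i)] [∀ j, NeZero (b₂ j)]
  {τ₁ τ₂ ε M : ℝ}

theorem usesAtMost_normEstimate (hE : ∀ N : ℕ, (E N (1 / 120)).UsesAtMost (CE * √N))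
    (hCE : 0 ≤ CE) (hM : √((n : ℝ) * m) ≤ M) {N : ℕ} (hN : (N : ℝ) ≤ 162 ^ 2 * (n * m)) :
    (E N (1 / 120)).UsesAtMost (162 * CE * M) := by
  have h_sqrt : √(N : ℝ) ≤ 162 * M :=
    calc √(N : ℝ) ≤ √(162 ^ 2 * (n * m)) := Real.sqrt_le_sqrt hN
      _ = 162 * √((n : ℝ) * m) := by rw [Real.sqrt_mul (by norm_num), Real.sqrt_sq (by norm_num)]
      _ ≤ 162 * M := by gcongr
  refine (hE N).mono ?_
  calc CE * √(N : ℝ) ≤ CE * (162 * M) := by gcongr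
    _ = 162 * CE * M := by ring

theorem usesAtMost_flattenedClosenessTest
    (hT : ∀ (N : ℕ) (b ε : ℝ), 0 < b → 0 < ε → ε < 1 →
      (T N b ε (1 / 80)).UsesAtMost (CT * (N * √b / ε ^ 2)))
    (hCT : 0 ≤ CT) (hτ₁ : 0 < τ₁) (hτ₂ : 0 < τ₂) (hε : 0 < ε) (hε' : ε < 1)
    (hb₁ : ((∑ i, b₁ i : ℕ) : ℝ) ≤ 162 * n) (hb₂ : ((∑ j, b₂ j : ℕ) : ℝ) ≤ 162 * m)
    (hτ : (n : ℝ) * m * √(τ₁ * τ₂) / ε ^ 2 ≤ 7 * M) :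
    (flattenedClosenessTest T b₁ b₂ τ₁ τ₂ ε).UsesAtMost (2 * 162 ^ 2 * 240 * 7 * CT * M) := by
  have h_sqrt : √(4 * 120 ^ 2 * τ₁ * τ₂) = 240 * √(τ₁ * τ₂) := by
    rw [show 4 * 120 ^ 2 * τ₁ * τ₂ = 240 ^ 2 * (τ₁ * τ₂) by ring, Real.sqrt_mul (by norm_num),
      Real.sqrt_sq (by norm_num)]
  have h_cost : CT * ((((∑ i, b₁ i) * ∑ j, b₂ j : ℕ) : ℝ) * √(4 * 120 ^ 2 * τ₁ * τ₂) / ε ^ 2)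
      ≤ 162 ^ 2 * 240 * 7 * CT * M := by
    rw [h_sqrt]
    calc CT * ((((∑ i, b₁ i) * ∑ j, b₂ j : ℕ) : ℝ) * (240 * √(τ₁ * τ₂)) / ε ^ 2)
        ≤ CT * (162 ^ 2 * (n * m) * (240 * √(τ₁ * τ₂)) / ε ^ 2) := by
          gcongr
          exact natCast_mul_le_sq_mul hb₁ hb₂
      _ = CT * (162 ^ 2 * 240) * (n * m * √(τ₁ * τ₂) / ε ^ 2) := by ring
      _ ≤ CT * (162 ^ 2 * 240) * (7 * M) := by gcongr
      _ = 162 ^ 2 * 240 * 7 * CT * M := by ring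
  refine ((((hT _ _ _ (by positivity) hε hε').mono h_cost).simulate zero_le_two
    fun i => ?_).bind le_rfl fun c => UsesAtMost.ret _ le_rfl).mono (le_of_eq (by ring))
  cases i
  · exact (usesAtMost_flatSampleJoint b₁ b₂).mono one_le_two
  · exact usesAtMost_flatSampleProd b₁ b₂

theorem usesAtMost_flattenedTest (hE : ∀ N : ℕ, (E N (1 / 120)).UsesAtMost (CE * √N))
    (hT : ∀ (N : ℕ) (b ε : ℝ), 0 < b → 0 < ε → ε < 1 →
      (T N b ε (1 / 80)).UsesAtMost (CT * (N * √b / ε ^ 2)))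
    (hCE : 0 ≤ CE) (hCT : 0 ≤ CT) (hn : 1 ≤ n) (hm : 1 ≤ m)
    (hτ₁ : 0 < τ₁) (hτ₂ : 0 < τ₂) (hε : 0 < ε) (hε' : ε < 1)
    (hb₁ : ((∑ i, b₁ i : ℕ) : ℝ) ≤ 162 * n) (hb₂ : ((∑ j, b₂ j : ℕ) : ℝ) ≤ 162 * m)
    (hM : √((n : ℝ) * m) ≤ M) (hτ : (n : ℝ) * m * √(τ₁ * τ₂) / ε ^ 2 ≤ 7 * M) :
    (flattenedTest E T b₁ b₂ τ₁ τ₂ ε).UsesAtMost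
      ((3 * 162 * CE + 2 * 162 ^ 2 * 240 * 7 * CT) * M) := by
  have hn' : (1 : ℝ) ≤ n := mod_cast hn
  have hm' : (1 : ℝ) ≤ m := mod_cast hm
  have hM' : 0 ≤ M := (Real.sqrt_nonneg _).trans hM
  have h_est₁ := usesAtMost_normEstimate hE hCE hM (hb₁.trans (by nlinarith))
  have h_est₂ := usesAtMost_normEstimate hE hCE hM (hb₂.trans (by nlinarith))
  have h_est := usesAtMost_normEstimate hE hCE hM (natCast_mul_le_sq_mul hb₁ hb₂)
  have h_close :=
    usesAtMost_flattenedClosenessTest b₁ b₂ hT hCT hτ₁ hτ₂ hε hε' hb₁ hb₂ hτ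
  have h_joint : (flattenedJointTest E T b₁ b₂ τ₁ τ₂ ε).UsesAtMost
      (1 * (162 * CE * M) + 2 * 162 ^ 2 * 240 * 7 * CT * M) := by
    refine (h_est.simulate zero_le_one fun _ => usesAtMost_flatSampleJoint b₁ b₂).bind
      h_close.nonneg fun L => ?_
    split_ifs
    exacts [UsesAtMost.ret _ h_close.nonneg, h_close]
  rw [flattenedTest_eq]
  refine UsesAtMost.mono (a := 1 * (162 * CE * M) + (1 * (162 * CE * M)
    + (1 * (162 * CE * M) + 2 * 162 ^ 2 * 240 * 7 * CT * M))) ?_ (le_of_eq (by ring))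
  refine (h_est₁.simulate zero_le_one fun _ => usesAtMost_flatSample₁ b₁).bind
    (by positivity) fun L₁ => ?_
  refine (h_est₂.simulate zero_le_one fun _ => usesAtMost_flatSample₂ b₂).bind
    (by positivity) fun L₂ => ?_
  split_ifs
  exacts [UsesAtMost.ret _ h_joint.nonneg, h_joint]

end FlattenedTest

theorem usesAtMost_augIndependenceTester
    (hE : ∀ N : ℕ, (E N (1 / 120)).UsesAtMost (CE * √N))
    (hT : ∀ (N : ℕ) (b ε : ℝ), 0 < b → 0 < ε → ε < 1 →
      (T N b ε (1 / 80)).UsesAtMost (CT * (N * √b / ε ^ 2)))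
    (hCE : 0 ≤ CE) (hCT : 0 ≤ CT) {n m : ℕ} {α ε : ℝ} (hm : 1 ≤ m) (hmn : m ≤ n)
    (hε : 0 < ε) (hε' : ε < 1) (hα : 0 ≤ α) (hα' : α ≤ 1) (phat : PMF (Fin n × Fin m)) :
    (augIndependenceTester E T n m α ε phat).UsesAtMost
      ((320 + (3 * 162 * CE + 2 * 162 ^ 2 * 240 * 7 * CT)) * sampleBound n m α ε) := by
  have hn : 1 ≤ n := hm.trans hmn
  have hmn' : (m : ℝ) ≤ n := mod_cast hmn
  have hs₁ : 0 ≤ firstRate n m α ε := firstRate_nonneg hε.le hα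
  have hs₂ : 0 ≤ m * α := by positivity
  have h_sqrt : √((n : ℝ) * m) ≤ sampleBound n m α ε := sqrt_le_sampleBound hε hε'.le
  have hM : 0 ≤ sampleBound n m α ε := (Real.sqrt_nonneg _).trans h_sqrt
  have hs₁_le : firstRate n m α ε ≤ sampleBound n m α ε :=
    (firstRate_eq hε.le).trans_le ((min_le_left _ _).trans (le_max_right _ _))
  have hs₁_le_n : firstRate n m α ε ≤ n :=
    (min_le_right _ _).trans (mul_le_of_le_one_right n.cast_nonneg hα')
  have hs₂_le_m : m * α ≤ m := mul_le_of_le_one_right m.cast_nonneg hα'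
  have hs₂_le : m * α ≤ sampleBound n m α ε :=
    hs₂_le_m.trans ((Real.le_sqrt_of_sq_le (by nlinarith)).trans h_sqrt)
  rw [augIndependenceTester_eq]
  refine (usesAtMost_poissonizedTest hs₁ hs₂
    (d := (3 * 162 * CE + 2 * 162 ^ 2 * 240 * 7 * CT) * sampleBound n m α ε) (by positivity)
    fun l₁ l₂ hl₁ hl₂ => ?_).mono (by linarith)
  exact usesAtMost_flattenedTest _ _ hE hT hCE hCT hn hm (threshold_pos hn hα hs₁)
    (threshold_pos hm hα hs₂) hε hε' ((sum_buckets_le _ _).trans (by linarith))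
    ((sum_buckets_le _ _).trans (by linarith)) h_sqrt (closenessCost_le hε hα)

end TesterCost

end

theorem theorem2 :
    (∃ E : (N : ℕ) → (δ : ℝ) → SampleProg Unit (Fin N) ℝ, IsL2NormEstimator E) ∧
    (∃ T : (N : ℕ) → (b ε δ : ℝ) → SampleProg Bool (Fin N) Bool, IsClosenessTester T) ∧
    ∀ (E : (N : ℕ) → (δ : ℝ) → SampleProg Unit (Fin N) ℝ)
      (T : (N : ℕ) → (b ε δ : ℝ) → SampleProg Bool (Fin N) Bool),
      IsL2NormEstimator E → IsClosenessTester T →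
      ∃ C : ℝ, 0 < C ∧ ∀ (n m : ℕ) (ε α : ℝ), 2 ≤ m → m ≤ n → 0 < ε → ε < 1 → 0 ≤ α → α ≤ 1 →
        IsAugIndependenceTester α ε 0.1 (augIndependenceTester E T n m α ε) ∧
        ∀ phat : PMF (Fin n × Fin m),
          (augIndependenceTester E T n m α ε phat).UsesAtMost
            (C * max (√((n : ℝ) * m) / ε ^ 2)
              ((n : ℝ) ^ (2 / 3 : ℝ) * (m : ℝ) ^ (1 / 3 : ℝ) * α ^ (1 / 3 : ℝ)
                / ε ^ (4 / 3 : ℝ))) := by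
  refine ⟨⟨_, isL2NormEstimator_normEstimator⟩, ⟨_, isClosenessTester_closenessTester⟩,
    fun E T hE hT => ?_⟩
  obtain ⟨CE, hCE, hE_cost⟩ := hE.exists_usesAtMost
  obtain ⟨CT, hCT, hT_cost⟩ := hT.exists_usesAtMost
  refine ⟨320 + (3 * 162 * CE + 2 * 162 ^ 2 * 240 * 7 * CT), by positivity,
    fun n m ε α hm hmn hε hε' hα hα' => ⟨?_, fun phat => ?_⟩⟩
  · exact isAugIndependenceTester_augIndependenceTester hE.normEstimatesCorrect
      hT.closenessTestsCorrect (by omega) (by omega) hε hε' hα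
  · exact usesAtMost_augIndependenceTester hE_cost hT_cost hCE hCT (by omega) hmn hε hε' hα hα' phat
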